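/- **Theorem (abstract sequential empirical CLT).** Let $(\mathcal X,\mathcal A)$ be a measurable space and let $(X_i)_{i\ge 0}$ be a stationary $\mathcal X$-valued process on a probability space $(\Omega,P)$ with marginal distribution $\mu$. Write $\mu f=\int f\,d\mu$, let $\|\cdot\|_s$ be the norm of $L^s(\mu)$ ($1\le s\le\infty$), with $\|\cdot\|_\infty$ the $\mu$-essential supremum norm, and let $[x]$ be the integer part of $x$. Let $\mathcal F$ be a $\|\cdot\|_\infty$-bounded class of measurable functions $\mathcal X\to\mathbb R$, let $(\mathcal C,\|\cdot\|_{\mathcal C})$ be a normed real vector space of measurable functions $\mathcal X\to\mathbb R$, and let $\mathcal G\subset\mathcal C$ be $\|\cdot\|_\infty$-bounded. For $n\in\mathbb N$ let $$U_n(f,t)=\frac1{\sqrt n}\sum_{i=1}^{[nt]}\bigl(f(X_i)-\mu f\bigr),\qquad t\in[0,1].$$ For $\varepsilon>0$ and $A\ge 0$, an $(\varepsilon,A,\mathcal G,L^s(\mu))$-bracket is a set $[l,u]=\{f:\mathcal X\to\mathbb R:\ l\le f\le u \text{ pointwise}\}$ with $l,u\in\mathcal G$, $l\le u$ pointwise,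 $\|u-l\|_s\le\varepsilon$, $\|l\|_{\mathcal C}\le A$ and $\|u\|_{\mathcal C}\le A$; $N(\varepsilon,A,\mathcal F,\mathcal G,L^s(\mu))\in\{0,1,2,\dots,\infty\}$ is the smallest number of such brackets that cover $\mathcal F$. Let $p\ge1$ be an integer, $s\in[1,\infty]$, and let $\Phi_1,\dots,\Phi_p:\mathbb R_+\to\mathbb R_+$ be monotone increasing. Assume: 1. (Finite-dimensional sequential CLT for $\mathcal G$.) For all $k$, $f_1,\dots,f_k\in\mathcal G$ and $t_1,\dots,t_k\in[0,1]$, the vector $(U_n(f_1,t_1),\dots,U_n(f_k,t_k))$ converges in distribution, as $n\to\infty$, to some (possibly degenerate) centred normal distribution $N(0,\Sigma)$ on $\mathbb R^k$. 2. (Moment bounds for $\mathcal G$.) For all $n\ge1$ and all $f\in\mathcal G\cup(\mathcal G-\mathcal G)$, $$E\Bigl[\Bigl(\sum_{i=1}^n\bigl(f(X_i)-\mu f\bigr)\Bigr)^{2p}\Bigr]\le\sum_{i=1}^p n^i\,\|f\|_s^i\,\Phi_i(\|f\|_{\mathcal C}).$$ 3. (Bracketing entropy.) There are $r>-1$ and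 a monotone increasing $\Psi:\mathbb R_+\to\mathbb R_+$ with $$\int_0^1\varepsilon^r\sup_{\varepsilon\le\delta\le1}N^2\bigl(\delta,\Psi(\delta^{-1}),\mathcal F,\mathcal G,L^s(\mu)\bigr)\,d\varepsilon<\infty.$$ 4. (Growth.) There are constants $\gamma_1,\dots,\gamma_p\ge0$ such that, for each $i=1,\dots,p$, $\Phi_i(2\Psi(x))=O(x^{\gamma_i})$ as $x\to\infty$ and $\gamma_i<2p-(i+r+2)$. Then the paths of $U_n$ belong to the space $\ell^\infty(\mathcal F\times[0,1])$ of bounded functions with the supremum norm, and $U_n$ converges in distribution in $\ell^\infty(\mathcal F\times[0,1])$ to a tight centred Gaussian process $K$; that is, there is a tight Borel random element $K$ of $\ell^\infty(\mathcal F\times[0,1])$ whose finite-dimensional marginals are (possibly degenerate) centred normal distributions, such that $E^*[\phi(U_n)]\to E[\phi(K)]$ for every bounded continuous $\phi:\ell^\infty(\mathcal F\times[0,1])\to\mathbb R$, where $E^*$ is the outer expectation. -/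

import Mathlib

open MeasureTheory ProbabilityTheory Filter Topology
open scoped ENNReal BoundedContinuousFunction Pointwise lp

noncomputable section

namespace SeqEmp

/-- The Banach space `ℓ^∞(T)` of bounded real-valued functions on `T` with the supremum norm. -/
abbrev LInfty (T : Type*) : Type _ := ℓ^∞(T, ℝ)

/-- `ℓ^∞(T)` carries its Borel σ-algebra. -/
instance instMeasurableSpaceLInfty (T : Type*) : MeasurableSpace (LInfty T) := borel _

instance instBorelSpaceLInfty (T : Type*) : BorelSpace (LInfty T) := ⟨rfl⟩

/-- The outer expectation `E^* Z` of a bounded, possibly non-measurable function `Z`: the infimum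
of `E Y` over all integrable random variables `Y ≥ Z`. -/
def outerExpectation {Ω : Type*} [MeasurableSpace Ω] (P : Measure Ω) (Z : Ω → ℝ) : ℝ :=
  sInf {e : ℝ | ∃ Y : Ω → ℝ, Measurable Y ∧ Integrable Y P ∧ (∀ ω, Z ω ≤ Y ω) ∧
    e = ∫ ω, Y ω ∂P}

/-- Weak convergence of (possibly non-measurable) maps `U n : Ω → E` to a random element of `E`
with law `ν`: `E^* φ(U n) → ∫ φ dν` for every bounded continuous `φ : E → ℝ`. -/
def WeakConvergesTo {Ω E : Type*} [MeasurableSpace Ω] [TopologicalSpace E] [MeasurableSpace E]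
    (P : Measure Ω) (U : ℕ → Ω → E) (ν : Measure E) : Prop :=
  ∀ φ : E →ᵇ ℝ,
    Tendsto (fun n : ℕ => outerExpectation P (fun ω => φ (U n ω))) atTop (𝓝 (∫ z, φ z ∂ν))

/-- `ν` is the law of a centred Gaussian process indexed by `T` with paths in `ℓ^∞(T)`: all finite
dimensional marginals are (possibly degenerate) normal distributions with mean zero. -/
def IsCentredGaussianLaw {T : Type*} (ν : Measure (LInfty T)) : Prop :=
  IsGaussianProcess (fun (τ : T) (z : LInfty T) => z τ) ν ∧
    ∀ τ : T, ∫ z : LInfty T, z τ ∂ν = 0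

variable {Ω 𝓧 : Type*} [MeasurableSpace Ω] [MeasurableSpace 𝓧]

/-- Stationarity: for each `k`, the shifted process `(X_{i+k})_{i ≥ 0}` has the law of
`(X_i)_{i ≥ 0}` on the sequence space. -/
def IsStationary (X : ℕ → Ω → 𝓧) (P : Measure Ω) : Prop :=
  ∀ k : ℕ, IdentDistrib (fun ω (i : ℕ) => X (i + k) ω) (fun ω (i : ℕ) => X i ω) P P

/-- The set `H` of functions is bounded in the (essential) supremum norm of `μ`. -/
def IsSupNormBounded (μ : Measure 𝓧) (H : Set (𝓧 → ℝ)) : Prop :=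
  ∃ M : ℝ, ∀ f ∈ H, ∀ᵐ x ∂μ, |f x| ≤ M

/-- `U_n(f,t) = n^{-1/2} ∑_{i=1}^{[nt]} (f(X_i) - μ f)`. -/
def seqEmpirical (X : ℕ → Ω → 𝓧) (μ : Measure 𝓧) (n : ℕ) (f : 𝓧 → ℝ) (t : ℝ) (ω : Ω) : ℝ :=
  (1 / √(n : ℝ)) * ∑ i ∈ Finset.Icc 1 ⌊(n : ℝ) * t⌋₊, (f (X i ω) - ∫ x, f x ∂μ)

section Bracketing

variable {C : Submodule ℝ (𝓧 → ℝ)}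

/-- The pair `(l, u)` defines an `(ε, A, G, L^s(μ))`-bracket `[l, u]`; `normC` is the norm
of the function space `C ⊇ G`. -/
structure IsBracket (normC : Seminorm ℝ C) (G : Set C) (μ : Measure 𝓧) (s : ℝ≥0∞) (ε A : ℝ)
    (l u : C) : Prop where
  mem_left : l ∈ G
  mem_right : u ∈ G
  le : ∀ x, (l : 𝓧 → ℝ) x ≤ (u : 𝓧 → ℝ) x
  eLpNorm_sub_le : eLpNorm ((u : 𝓧 → ℝ) - (l : 𝓧 → ℝ)) s μ ≤ ENNReal.ofReal ε
  norm_right : normC u ≤ A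
  norm_left : normC l ≤ A

/-- The bracketing number `N(ε, A, F, G, L^s(μ))`: the smallest number of
`(ε, A, G, L^s(μ))`-brackets that cover `F` (`∞` if no finite number does). -/
def bracketingNumber (normC : Seminorm ℝ C) (G : Set C) (μ : Measure 𝓧) (s : ℝ≥0∞) (ε A : ℝ)
    (F : Set (𝓧 → ℝ)) : ℕ∞ :=
  ⨅ (S : Set (C × C)) (_ : ∀ b ∈ S, IsBracket normC G μ s ε A b.1 b.2)
    (_ : ∀ f ∈ F, ∃ b ∈ S, ∀ x, (b.1 : 𝓧 → ℝ) x ≤ f x ∧ f x ≤ (b.2 : 𝓧 → ℝ) x), S.encard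

/-- The bracketing integral `∫_0^1 ε^r sup_{ε ≤ δ ≤ 1} N²(δ, Ψ(δ⁻¹), F, G, L^s(μ)) dε`. -/
def bracketingIntegral (normC : Seminorm ℝ C) (G : Set C) (μ : Measure 𝓧) (s : ℝ≥0∞) (r : ℝ)
    (Ψ : ℝ → ℝ) (F : Set (𝓧 → ℝ)) : ℝ≥0∞ :=
  ∫⁻ ε in Set.Ioo (0 : ℝ) 1, ENNReal.ofReal (ε ^ r) *
    ⨆ δ ∈ Set.Icc ε 1, ((bracketingNumber normC G μ s δ (Ψ δ⁻¹) F : ℕ∞) : ℝ≥0∞) ^ 2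

/-- Finite dimensional sequential CLT for `G`-observables: for all `f_1, …, f_k ∈ G` and
`t_1, …, t_k ∈ [0,1]`, the vector `(U_n(f_1,t_1), …, U_n(f_k,t_k))` converges in distribution to
some centred, possibly degenerate, normal law `N(0, S)`. -/
def FidiSeqCLT (X : ℕ → Ω → 𝓧) (P : Measure Ω) [IsProbabilityMeasure P] (μ : Measure 𝓧)
    (G : Set C) : Prop :=
  ∀ (k : ℕ) (f : Fin k → C) (t : Fin k → ℝ), (∀ j, f j ∈ G) → (∀ j, t j ∈ Set.Icc (0 : ℝ) 1) →
    ∃ S : Matrix (Fin k) (Fin k) ℝ, S.PosSemidef ∧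
      TendstoInDistribution
        (fun (n : ℕ) (ω : Ω) => WithLp.toLp 2 (fun j => seqEmpirical X μ n (f j) (t j) ω))
        atTop (id : EuclideanSpace ℝ (Fin k) → EuclideanSpace ℝ (Fin k))
        (fun _ => P) (multivariateGaussian 0 S)

/-- `2p`-th moment bounds for `G`-observables: for all `n` and all `f ∈ G ∪ (G - G)`,
`E (∑_{i=1}^n (f(X_i) - μ f))^{2p} ≤ ∑_{i=1}^p n^i ‖f‖_s^i Φ_i(‖f‖_C)`. -/
def MomentBound (X : ℕ → Ω → 𝓧) (P : Measure Ω) (μ : Measure 𝓧) (normC : Seminorm ℝ C)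
    (G : Set C) (p : ℕ) (s : ℝ≥0∞) (Φ : ℕ → ℝ → ℝ) : Prop :=
  ∀ n : ℕ, 1 ≤ n → ∀ f ∈ G ∪ (G - G),
    ∫ ω, (∑ i ∈ Finset.Icc 1 n, ((f : 𝓧 → ℝ) (X i ω) - ∫ x, (f : 𝓧 → ℝ) x ∂μ)) ^ (2 * p) ∂P ≤
      ∑ i ∈ Finset.Icc 1 p,
        (n : ℝ) ^ i * (eLpNorm (f : 𝓧 → ℝ) s μ).toReal ^ i * Φ i (normC f)

end Bracketing

end SeqEmp

end

/-! The process is compared, uniformly in `(f, t)`, with finitely many coordinates of the same kind.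
At dyadic level `k`, cover `F` by brackets of `L^s`-size `2^(-k)`, replace `f` by the lower end `l`
of a bracket `[l, u]` around it, and `t` by `⌊2^k t⌋ / 2^k`. At a fixed level `q` this is a finite
vector of `G`-observables, so it has a centred normal limit. It remains to bound the error, and to
pass from the levels `q` to a limit law.

The error is bounded by chaining in function and time at once, from level `q` to a level `K` with
`2^K` of order `√n / η`. Every link is a block sum for which block length times `L^s`-norm is `O(n
2^(-k))`: either the block is short or the function is small. Markov's inequality for the `2p`-th
moment and the growth condition bound the probability that a link exceeds `η ρ^k √n` by a multiple
of `2^(-k(r+2))`; the strict inequality for `γ i` leaves room for some `ρ < 1`. There are about `N_k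
N_(k+1) 2^k` links, so a level costs a multiple of `2^(-k(r+1)) (N_k² + N_(k+1)²)`, which is
summable by the entropy condition (`MomentSetting.measure_levelEvent_le`). At level `K` the bracket
closes the chain: `0 ≤ f - l ≤ u - l`, where the fluctuation of `u - l` is itself a link and its
mean contributes at most `n 2^(-K) ≤ η √n` (`MomentSetting.abs_centredSum_sub_le`).

The limit is then soft (`exists_gaussian_weakConvergesTo`). The limit laws of the approximations are
close to one another, hence uniformly tight; any cluster point of them is the limit of the process,
and it is Gaussian because weak limits of centred normal laws are centred normal. Covariances never
have to be identified. -/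

noncomputable section

namespace SeqEmp

/-! ### Weak limits of centred normal laws -/

/-- Weak limits of centred normal laws on `ℝ` are centred normal. -/
theorem exists_eq_gaussianReal_of_tendsto {ι : Type*} {l : Filter ι} [l.NeBot]
    {ρ : ι → ProbabilityMeasure ℝ} {ν : ProbabilityMeasure ℝ}
    (hρ : ∀ i, ∃ v, (ρ i : Measure ℝ) = gaussianReal 0 v) (h : Tendsto ρ l (𝓝 ν)) :
    ∃ v, (ν : Measure ℝ) = gaussianReal 0 v := by
  choose v hv using hρ
  have hchar : ∀ t : ℝ, Tendsto (fun i => ((Real.exp (-(v i : ℝ) * t ^ 2 / 2) : ℝ) : ℂ)) l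
      (𝓝 (charFun (ν : Measure ℝ) t)) := by
    intro t
    have h' := h
    rw [ProbabilityMeasure.tendsto_iff_forall_integral_rclike_tendsto ℂ] at h'
    have h1 := h' (BoundedContinuousFunction.innerProbChar t)
    simp_rw [← charFun_eq_integral_innerProbChar] at h1
    refine h1.congr fun i => ?_
    rw [hv i, charFun_gaussianReal]
    push_cast
    congr 1
    ring
  have hre : ∀ t : ℝ, Tendsto (fun i => Real.exp (-(v i : ℝ) * t ^ 2 / 2)) l
      (𝓝 (charFun (ν : Measure ℝ) t).re) := fun t => by
    refine ((Complex.continuous_re.tendsto _).comp (hchar t)).congr fun i => ?_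
    rw [Function.comp_apply, Complex.ofReal_re]
  have him : ∀ t : ℝ, charFun (ν : Measure ℝ) t = ((charFun (ν : Measure ℝ) t).re : ℂ) := fun t =>
    tendsto_nhds_unique (hchar t) ((Complex.continuous_ofReal.tendsto _).comp (hre t))
  -- One nonzero frequency at which the limiting characteristic function is positive suffices: the
  -- logarithm there recovers the variances, which therefore converge.
  obtain ⟨t₀, ht₀, hpos⟩ : ∃ t : ℝ, t ≠ 0 ∧ 0 < (charFun (ν : Measure ℝ) t).re := by
    have hc : Continuous fun t => (charFun (ν : Measure ℝ) t).re :=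
      Complex.continuous_re.comp continuous_charFun
    have h0 : ∀ᶠ t in 𝓝 (0 : ℝ), 0 < (charFun (ν : Measure ℝ) t).re :=
      hc.continuousAt.eventually (lt_mem_nhds (by simp))
    have h1 : ∀ᶠ t in 𝓝[≠] (0 : ℝ), 0 < (charFun (ν : Measure ℝ) t).re :=
      h0.filter_mono nhdsWithin_le_nhds
    obtain ⟨t, ht, ht'⟩ := (h1.and self_mem_nhdsWithin).exists
    exact ⟨t, ht', ht⟩
  have hlog := ((Real.continuousAt_log hpos.ne').tendsto.comp (hre t₀))
  have hvlim : Tendsto (fun i => (v i : ℝ)) l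
      (𝓝 (-2 / t₀ ^ 2 * Real.log (charFun (ν : Measure ℝ) t₀).re)) := by
    refine (hlog.const_mul (-2 / t₀ ^ 2)).congr fun i => ?_
    simp only [Function.comp, Real.log_exp]
    field_simp
  set w : ℝ := -2 / t₀ ^ 2 * Real.log (charFun (ν : Measure ℝ) t₀).re with hw
  have hw0 : 0 ≤ w := ge_of_tendsto' hvlim fun i => (v i).2
  lift w to NNReal using hw0 with w'
  refine ⟨w', Measure.ext_of_charFun (funext fun t => ?_)⟩
  rw [him t, charFun_gaussianReal]
  have : (charFun (ν : Measure ℝ) t).re = Real.exp (-w' * t ^ 2 / 2) := by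
    refine tendsto_nhds_unique (hre t) ?_
    exact (Real.continuous_exp.tendsto _).comp (((hvlim.neg).mul_const _).div_const _)
  rw [this]
  push_cast
  congr 1
  ring

/-! ### Uniform tightness from approximate concentration -/

section Tight

variable {E : Type*} [MetricSpace E] [CompleteSpace E] [MeasurableSpace E]

/-- A sequence of tight measures is uniformly tight if it is asymptotically concentrated near
compact sets charged by its members. -/
theorem isTightMeasureSet_range_of_cthickening (ν : ℕ → Measure E)
    (htight : ∀ q, IsTightMeasureSet {ν q})
    (h : ∀ δ : ℝ, 0 < δ → ∀ η : ℝ≥0∞, 0 < η → ∃ q₀, ∀ q, q₀ ≤ q → ∀ L, IsCompact L →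
      ν q (Metric.cthickening δ L)ᶜ ≤ ν q₀ Lᶜ + η) :
    IsTightMeasureSet (Set.range ν) := by
  rw [isTightMeasureSet_iff_exists_isCompact_measure_compl_le]
  intro ε hε
  have key : ∀ δ : ℝ, 0 < δ → ∀ η : ℝ≥0∞, 0 < η → ∃ L, IsCompact L ∧
      ∀ q, ν q (Metric.cthickening δ L)ᶜ ≤ η := by
    intro δ hδ η hη
    obtain ⟨q₀, hq₀⟩ := h δ hδ (η / 2) (ENNReal.half_pos hη.ne')
    have hL : ∀ q, ∃ L, IsCompact L ∧ ν q Lᶜ ≤ η / 2 := fun q => by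
      obtain ⟨L, hL, hL'⟩ := isTightMeasureSet_iff_exists_isCompact_measure_compl_le.1 (htight q)
        (η / 2) (ENNReal.half_pos hη.ne')
      exact ⟨L, hL, hL' _ rfl⟩
    choose L hLc hLm using hL
    -- The members up to `q₀` are handled by their own compact sets, all later ones by thickening
    -- the set of `q₀`.
    refine ⟨⋃ q ∈ Finset.range (q₀ + 1), L q,
      (Finset.range (q₀ + 1)).isCompact_biUnion fun q _ => hLc q, fun q => ?_⟩
    have hsub : ∀ j ≤ q₀, L j ⊆ ⋃ q ∈ Finset.range (q₀ + 1), L q := fun j hj =>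
      Set.subset_biUnion_of_mem (u := L) (by simpa using Nat.lt_succ_of_le hj)
    rcases le_total q₀ q with hq | hq
    · calc ν q (Metric.cthickening δ (⋃ q ∈ Finset.range (q₀ + 1), L q))ᶜ
          ≤ ν q (Metric.cthickening δ (L q₀))ᶜ := by
            refine measure_mono (Set.compl_subset_compl.2 ?_)
            exact Metric.cthickening_subset_of_subset _ (hsub q₀ le_rfl)
        _ ≤ ν q₀ (L q₀)ᶜ + η / 2 := hq₀ q hq _ (hLc q₀)
        _ ≤ η / 2 + η / 2 := by gcongr; exact hLm q₀
        _ = η := ENNReal.add_halves η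
    · calc ν q (Metric.cthickening δ (⋃ q ∈ Finset.range (q₀ + 1), L q))ᶜ
          ≤ ν q (L q)ᶜ := by
            gcongr
            exact (hsub q hq).trans (Metric.self_subset_cthickening _)
        _ ≤ η / 2 := hLm q
        _ ≤ η := ENNReal.half_le_self
  obtain ⟨ε', hε'pos, hε'sum⟩ := ENNReal.exists_pos_sum_of_countable' hε.ne' ℕ
  choose! L hLc hLm using key
  let δ : ℕ → ℝ := fun m => 1 / ((m : ℝ) + 1)
  have hδ : ∀ m, 0 < δ m := fun m => by positivity
  -- Closed, and totally bounded because it lies near a compact set at every scale; completeness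
  -- makes it compact.
  let K : Set E := ⋂ m, Metric.cthickening (δ m) (L (δ m) (ε' m))
  refine ⟨K, ?_, ?_⟩
  · refine TotallyBounded.isCompact_of_isClosed ?_ (isClosed_iInter fun _ => Metric.isClosed_cthickening)
    rw [Metric.totallyBounded_iff]
    intro e he
    obtain ⟨m, hm⟩ := exists_nat_one_div_lt (half_pos (half_pos he))
    obtain ⟨t, htf, ht⟩ := Metric.totallyBounded_iff.1
      (hLc (δ m) (hδ m) (ε' m) (hε'pos m)).totallyBounded (e / 2) (half_pos he)
    refine ⟨t, htf, fun x hx => ?_⟩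
    have hx' : x ∈ Metric.thickening (e / 2) (L (δ m) (ε' m)) :=
      Metric.cthickening_subset_thickening' (half_pos he)
        (by change 1 / ((m : ℝ) + 1) < e / 2; linarith) _ (Set.mem_iInter.1 hx m)
    obtain ⟨y, hy, hxy⟩ := Metric.mem_thickening_iff.1 hx'
    obtain ⟨z, hz, hyz⟩ := Set.mem_iUnion₂.1 (ht hy)
    refine Set.mem_iUnion₂.2 ⟨z, hz, ?_⟩
    rw [Metric.mem_ball] at hyz ⊢
    linarith [dist_triangle x y z]
  · rintro _ ⟨q, rfl⟩
    calc ν q Kᶜ = ν q (⋃ m, (Metric.cthickening (δ m) (L (δ m) (ε' m)))ᶜ) := by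
          rw [Set.compl_iInter]
      _ ≤ ∑' m, ν q (Metric.cthickening (δ m) (L (δ m) (ε' m)))ᶜ := measure_iUnion_le _
      _ ≤ ∑' m, ε' m := ENNReal.tsum_le_tsum fun m => hLm _ (hδ m) _ (hε'pos m) q
      _ ≤ ε := hε'sum.le

end Tight

/-! ### Outer expectations -/

section OuterExpectation

variable {Ω : Type*} [MeasurableSpace Ω] {P : Measure Ω} [IsProbabilityMeasure P]

/-- The outer expectation of a bounded map is close to the expectation of a random variable which
is close to it with high probability. -/
theorem abs_outerExpectation_sub_integral_le {Z W : Ω → ℝ} {M ε η : ℝ} (hM : 0 ≤ M)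
    (hZ : ∀ ω, |Z ω| ≤ M) (hW : ∀ ω, |W ω| ≤ M) (hWm : Measurable W)
    (h : P {ω | ε < |Z ω - W ω|} ≤ ENNReal.ofReal η) (hε : 0 ≤ ε) (hη : 0 ≤ η) :
    |outerExpectation P Z - ∫ ω, W ω ∂P| ≤ ε + 2 * M * η := by
  set B := toMeasurable P {ω | ε < |Z ω - W ω|} with hB
  have hBm : MeasurableSet B := measurableSet_toMeasurable _ _
  have hPB : P.real B ≤ η := by
    rw [Measure.real, hB, measure_toMeasurable]
    exact ENNReal.toReal_le_of_le_ofReal hη h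
  have hWi : Integrable W P := Integrable.of_bound hWm.aestronglyMeasurable M (ae_of_all _ hW)
  -- A measurable majorant of `|Z - W|`. Then `W + D` is admissible in the infimum, and every
  -- admissible `Y` satisfies `W ≤ Y + D`, which gives the two inequalities.
  obtain ⟨D, hDm, hDi, hpt, hint⟩ : ∃ D : Ω → ℝ, Measurable D ∧ Integrable D P ∧
      (∀ ω, |Z ω - W ω| ≤ D ω) ∧ ∫ ω, D ω ∂P ≤ ε + 2 * M * η := by
    have hIi : Integrable (fun ω => 2 * M * B.indicator (fun _ => (1 : ℝ)) ω) P :=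
      ((integrable_const (1 : ℝ)).indicator hBm).const_mul _
    refine ⟨fun ω => ε + 2 * M * B.indicator (fun _ => (1 : ℝ)) ω,
      measurable_const.add (measurable_const.mul (measurable_const.indicator hBm)),
      (integrable_const ε).add hIi, fun ω => ?_, ?_⟩
    · beta_reduce
      by_cases hω : ω ∈ B
      · rw [Set.indicator_of_mem hω]
        have := abs_sub (Z ω) (W ω)
        linarith [hZ ω, hW ω]
      · rw [Set.indicator_of_notMem hω]
        have : ¬ ε < |Z ω - W ω| := fun h' => hω (subset_toMeasurable _ _ h')
        linarith
    · rw [integral_add (integrable_const ε) hIi, integral_const_mul, integral_indicator hBm]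
      simp only [integral_const, smul_eq_mul, mul_one, measureReal_restrict_apply_univ,
        probReal_univ, one_mul]
      gcongr
  have hbdd : ∀ e ∈ {e : ℝ | ∃ Y : Ω → ℝ, Measurable Y ∧ Integrable Y P ∧ (∀ ω, Z ω ≤ Y ω) ∧
      e = ∫ ω, Y ω ∂P}, ∫ ω, W ω ∂P - (ε + 2 * M * η) ≤ e := by
    rintro e ⟨Y, -, hYi, hY, rfl⟩
    have : ∫ ω, W ω ∂P ≤ ∫ ω, (Y ω + D ω) ∂P := by
      refine integral_mono hWi (hYi.add hDi) fun ω => ?_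
      have h1 := (abs_le.1 (hpt ω)).1
      have h2 := hY ω
      simp only
      linarith
    rw [integral_add hYi hDi] at this
    linarith
  rw [abs_le]
  constructor
  · rw [neg_le_sub_iff_le_add, ← sub_le_iff_le_add]
    refine le_csInf ?_ hbdd
    exact ⟨_, fun _ => M, measurable_const, integrable_const _,
      fun ω => (le_abs_self _).trans (hZ ω), rfl⟩
  · rw [sub_le_iff_le_add]
    refine (csInf_le ⟨_, hbdd⟩ ⟨fun ω => W ω + D ω, hWm.add hDm, hWi.add hDi, fun ω => ?_,
      rfl⟩).trans ?_
    · linarith [(abs_le.1 (hpt ω)).2]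
    · rw [integral_add hWi hDi]
      linarith

end OuterExpectation

/-! ### Weak convergence by approximation in probability -/

section Approx

variable {Ω E : Type*} [MeasurableSpace Ω] {P : Measure Ω} [IsProbabilityMeasure P]
  [MetricSpace E] [MeasurableSpace E] [BorelSpace E]
  {U : ℕ → Ω → E} {V : ℕ → ℕ → Ω → E} {ν : ℕ → ProbabilityMeasure E}

/-- For `q ≥ q₀`, both `V q n` and `V q₀ n` are close to `U n`, hence to each other, with high
probability. The portmanteau theorem, for a closed set at `q₀` and an open set at `q`, carries this
over to the limit laws. No measurability of `U n` is needed. -/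
theorem isTightMeasureSet_range_of_approx [CompleteSpace E]
    (hVm : ∀ q n, Measurable (V q n))
    (hV : ∀ q, Tendsto (β := ProbabilityMeasure E) (fun n => ⟨P.map (V q n),
      Measure.isProbabilityMeasure_map (hVm q n).aemeasurable⟩) atTop
      (𝓝 (ν q)))
    (htight : ∀ q, IsTightMeasureSet {(ν q : Measure E)})
    (happrox : ∀ δ : ℝ, 0 < δ → ∀ η : ℝ≥0∞, 0 < η → ∃ q₀, ∀ q, q₀ ≤ q →
      ∀ᶠ n in atTop, P {ω | δ < dist (U n ω) (V q n ω)} ≤ η) :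
    IsTightMeasureSet (Set.range fun q => (ν q : Measure E)) := by
  refine isTightMeasureSet_range_of_cthickening _ htight fun δ hδ η hη => ?_
  have hη3 : 0 < η / 3 := ENNReal.div_pos hη.ne' (by simp)
  obtain ⟨q₀, hq₀⟩ := happrox (δ / 4) (by positivity) (η / 3) hη3
  refine ⟨q₀, fun q hq L _ => ?_⟩
  have hcl : IsClosed (Metric.thickening (δ / 4) L)ᶜ := Metric.isOpen_thickening.isClosed_compl
  have hop : IsOpen (Metric.cthickening δ L)ᶜ := Metric.isClosed_cthickening.isOpen_compl
  have hlim : limsup (fun n => P.map (V q₀ n) (Metric.thickening (δ / 4) L)ᶜ) atTop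
      < (ν q₀ : Measure E) Lᶜ + η / 3 := by
    refine (ProbabilityMeasure.limsup_measure_closed_le_of_tendsto (hV q₀) hcl).trans_lt ?_
    refine (measure_mono (Set.compl_subset_compl.2
      (Metric.self_subset_thickening (by positivity) L))).trans_lt ?_
    exact ENNReal.lt_add_right (measure_ne_top _ _) hη3.ne'
  have hev := eventually_lt_of_limsup_lt hlim
  refine (ProbabilityMeasure.le_liminf_measure_open_of_tendsto (hV q) hop).trans ?_
  refine liminf_le_of_frequently_le' (Eventually.frequently ?_)
  filter_upwards [hev, hq₀ q₀ le_rfl, hq₀ q hq] with n h1 h2 h3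
  rw [Measure.map_apply (hVm _ _) hcl.measurableSet] at h1
  change P.map (V q n) _ ≤ _
  rw [Measure.map_apply (hVm _ _) hop.measurableSet]
  have hsub : V q n ⁻¹' (Metric.cthickening δ L)ᶜ ⊆
      (V q₀ n ⁻¹' (Metric.thickening (δ / 4) L)ᶜ ∪ {ω | δ / 4 < dist (U n ω) (V q₀ n ω)}) ∪
        {ω | δ / 4 < dist (U n ω) (V q n ω)} := by
    intro ω hω
    by_contra hcon
    simp only [Set.mem_union, Set.mem_preimage, Set.mem_compl_iff, Set.mem_ofPred_eq, not_or,
      not_not, not_lt] at hcon hω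
    obtain ⟨⟨hc1, hc2⟩, hc3⟩ := hcon
    obtain ⟨z, hz, hd⟩ := Metric.mem_thickening_iff.1 hc1
    refine hω (Metric.mem_cthickening_of_dist_le _ z _ _ hz ?_)
    have := dist_triangle (V q n ω) (U n ω) (V q₀ n ω)
    linarith [dist_comm (V q n ω) (U n ω), dist_triangle (V q n ω) (V q₀ n ω) z]
  calc P (V q n ⁻¹' (Metric.cthickening δ L)ᶜ)
      ≤ (((ν q₀ : Measure E) Lᶜ + η / 3) + η / 3) + η / 3 :=
        (measure_mono hsub).trans ((measure_union_le _ _).trans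
          (add_le_add ((measure_union_le _ _).trans (add_le_add h1.le h2)) h3))
    _ = (ν q₀ : Measure E) Lᶜ + η := by
        rw [add_assoc, add_assoc, ← add_assoc (η / 3), ENNReal.add_thirds]

/-- A sequence of maps into a complete metric space which is approximated in probability by
sequences converging weakly to tight laws converges weakly to a tight law, which is a cluster point
of the approximating laws. -/
theorem exists_weakConvergesTo_of_approx [CompleteSpace E]
    (hVm : ∀ q n, Measurable (V q n))
    (hV : ∀ q, Tendsto (β := ProbabilityMeasure E) (fun n => ⟨P.map (V q n),
      Measure.isProbabilityMeasure_map (hVm q n).aemeasurable⟩) atTop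
      (𝓝 (ν q)))
    (htight : ∀ q, IsTightMeasureSet {(ν q : Measure E)})
    (happrox : ∀ δ : ℝ, 0 < δ → ∀ η : ℝ≥0∞, 0 < η → ∃ q₀, ∀ q, q₀ ≤ q →
      ∀ᶠ n in atTop, P {ω | δ < dist (U n ω) (V q n ω)} ≤ η) :
    ∃ (ν' : ProbabilityMeasure E) (l : Filter ℕ), l.NeBot ∧ Tendsto ν l (𝓝 ν') ∧
      IsTightMeasureSet {(ν' : Measure E)} ∧ WeakConvergesTo P U (ν' : Measure E) := by
  have hT := isTightMeasureSet_range_of_approx hVm hV htight happrox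
  have hcomp : IsCompact (closure (Set.range ν)) := by
    refine isCompact_closure_of_isTightMeasureSet (hT.subset ?_)
    rintro _ ⟨_, ⟨q, rfl⟩, rfl⟩
    exact ⟨q, rfl⟩
  -- An ultrafilter limit plays the role of a convergent subsequence given by Prokhorov's theorem.
  obtain ⟨ν', -, hν'⟩ := hcomp.ultrafilter_le_nhds' ((hyperfilter ℕ).map ν)
    (Filter.mem_map.2 (Filter.Eventually.of_forall fun q => subset_closure ⟨q, rfl⟩))
  have hlim : Tendsto ν (hyperfilter ℕ) (𝓝 ν') := hν'
  rw [isTightMeasureSet_iff_exists_isCompact_measure_compl_le] at hT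
  refine ⟨ν', hyperfilter ℕ, inferInstance, hlim, ?_, fun φ => ?_⟩
  · rw [isTightMeasureSet_iff_exists_isCompact_measure_compl_le]
    intro ε hε
    obtain ⟨K, hK, hKm⟩ := hT ε hε
    refine ⟨K, hK, ?_⟩
    rintro _ rfl
    refine (ProbabilityMeasure.le_liminf_measure_open_of_tendsto hlim
      hK.isClosed.isOpen_compl).trans ?_
    exact liminf_le_of_frequently_le' (Frequently.of_forall fun q => hKm _ ⟨q, rfl⟩)
  · rw [Metric.tendsto_nhds]
    intro ε hε
    set M : ℝ := ‖φ‖ with hM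
    have hM0 : 0 ≤ M := norm_nonneg _
    have hφM : ∀ x, |φ x| ≤ M := fun x => φ.norm_coe_le_norm x
    -- The errors to come are `2e + 2M · 3e` from the outer expectation and `e` from each of two
    -- comparisons of integrals, in total below `(8M + 8) e`.
    set e : ℝ := ε / (8 * (M + 1)) with he
    have he0 : 0 < e := by positivity
    have heε : (8 * M + 8) * e = ε := by rw [he]; field_simp
    obtain ⟨K, hK, hKm⟩ := hT (ENNReal.ofReal e) (by simpa using he0)
    have hunif := hK.uniformContinuousAt_of_continuousAt (φ : E → ℝ)
      (fun a _ => φ.continuous.continuousAt) (Metric.dist_mem_uniformity he0)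
    obtain ⟨δ, hδ, hδφ⟩ := Metric.mem_uniformity_dist.1 hunif
    obtain ⟨q₀, hq₀⟩ := happrox (δ / 2) (by positivity) (ENNReal.ofReal e) (by simpa using he0)
    have hnear : ∀ᶠ q in (hyperfilter ℕ : Filter ℕ),
        dist (∫ z, φ z ∂(ν q : Measure E)) (∫ z, φ z ∂(ν' : Measure E)) < e :=
      (ProbabilityMeasure.tendsto_iff_forall_integral_tendsto.1 hlim φ).eventually
        (Metric.ball_mem_nhds _ he0)
    -- A single good `q` serves all large `n`, so the whole sequence `U n` converges although `ν'`
    -- is only a cluster point.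
    obtain ⟨q, hqφ, hq⟩ := (hnear.and
      (Nat.hyperfilter_le_atTop (eventually_ge_atTop q₀))).exists
    have h1 : ∀ᶠ n in atTop, dist (∫ z, φ z ∂(P.map (V q n))) (∫ z, φ z ∂(ν q : Measure E)) < e :=
      (ProbabilityMeasure.tendsto_iff_forall_integral_tendsto.1 (hV q) φ).eventually
        (Metric.ball_mem_nhds _ he0)
    have hcl : IsClosed (Metric.thickening (δ / 2) K)ᶜ := Metric.isOpen_thickening.isClosed_compl
    have h2 : ∀ᶠ n in atTop, P.map (V q n) (Metric.thickening (δ / 2) K)ᶜ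
        < ENNReal.ofReal (2 * e) := by
      refine eventually_lt_of_limsup_lt ?_
      refine (ProbabilityMeasure.limsup_measure_closed_le_of_tendsto (hV q) hcl).trans_lt ?_
      refine (measure_mono (Set.compl_subset_compl.2
        (Metric.self_subset_thickening (by positivity) K))).trans_lt ?_
      refine (hKm _ ⟨q, rfl⟩).trans_lt ?_
      rw [ENNReal.ofReal_lt_ofReal_iff (by positivity)]
      linarith
    filter_upwards [h1, h2, hq₀ q hq] with n hn1 hn2 hn3
    rw [Measure.map_apply (hVm _ _) hcl.measurableSet] at hn2
    rw [integral_map (hVm q n).aemeasurable φ.continuous.aestronglyMeasurable] at hn1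
    have hout := abs_outerExpectation_sub_integral_le (P := P) (Z := fun ω => φ (U n ω))
      (W := fun ω => φ (V q n ω)) (M := M) (ε := 2 * e) (η := 3 * e) hM0 (fun ω => hφM _)
      (fun ω => hφM _) (φ.continuous.measurable.comp (hVm q n)) ?_ (by positivity) (by positivity)
    · rw [Real.dist_eq] at hqφ hn1 ⊢
      have t1 := abs_sub_le (outerExpectation P fun ω => φ (U n ω)) (∫ ω, φ (V q n ω) ∂P)
        (∫ z, φ z ∂(ν' : Measure E))
      have t2 := abs_sub_le (∫ ω, φ (V q n ω) ∂P) (∫ z, φ z ∂(ν q : Measure E))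
        (∫ z, φ z ∂(ν' : Measure E))
      have : 0 ≤ M * e := by positivity
      nlinarith
    · have hsub : {ω | 2 * e < |φ (U n ω) - φ (V q n ω)|} ⊆
          {ω | δ / 2 < dist (U n ω) (V q n ω)} ∪ V q n ⁻¹' (Metric.thickening (δ / 2) K)ᶜ := by
        intro ω hω
        by_contra hcon
        simp only [Set.mem_union, Set.mem_preimage, Set.mem_compl_iff, Set.mem_ofPred_eq, not_or,
          not_not, not_lt] at hcon hω
        obtain ⟨hc1, hc2⟩ := hcon
        obtain ⟨z, hz, hd⟩ := Metric.mem_thickening_iff.1 hc2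
        have hzV : dist z (V q n ω) < δ := by rw [dist_comm]; linarith
        have hzU : dist z (U n ω) < δ := by
          have := dist_triangle z (V q n ω) (U n ω)
          linarith [dist_comm z (V q n ω), dist_comm (V q n ω) (U n ω)]
        have d1 : dist (φ z) (φ (V q n ω)) < e := hδφ hzV hz
        have d2 : dist (φ z) (φ (U n ω)) < e := hδφ hzU hz
        have := dist_triangle_left (φ (U n ω)) (φ (V q n ω)) (φ z)
        rw [Real.dist_eq] at this
        linarith
      refine (measure_mono hsub).trans ((measure_union_le _ _).trans
        ((add_le_add hn3 hn2.le).trans ?_))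
      rw [← ENNReal.ofReal_add he0.le (by positivity)]
      exact ENNReal.ofReal_le_ofReal (by linarith)

end Approx

/-! ### Centred Gaussian laws on `ℓ^∞(T)` -/

/-- The element of `ℓ^∞(T)` given by a bounded function. -/
def LInfty.ofBounded {T : Type*} (f : T → ℝ) (hf : ∃ C, ∀ τ, |f τ| ≤ C) : LInfty T :=
  ⟨f, memℓp_infty ⟨hf.choose, by rintro _ ⟨τ, rfl⟩; exact hf.choose_spec τ⟩⟩

@[simp]
theorem LInfty.ofBounded_apply {T : Type*} (f : T → ℝ) (hf : ∃ C, ∀ τ, |f τ| ≤ C) (τ : T) :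
    LInfty.ofBounded f hf τ = f τ := rfl

/-- Composition with `idx : T → Fin k` as a map from `ℝ^k` to `ℓ^∞(T)`. -/
def LInfty.pullback {T : Type*} {k : ℕ} (idx : T → Fin k) :
    EuclideanSpace ℝ (Fin k) →L[ℝ] LInfty T :=
  LinearMap.toContinuousLinearMap
    { toFun := fun z => LInfty.ofBounded (fun τ => z (idx τ))
        ⟨‖z‖, fun τ => PiLp.norm_apply_le z (idx τ)⟩
      map_add' := fun _ _ => rfl
      map_smul' := fun _ _ => rfl }

theorem LInfty.exists_lt_abs_of_lt_dist {T : Type*} {x y : LInfty T} {δ : ℝ} (hδ : 0 ≤ δ)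
    (h : δ < dist x y) : ∃ τ, δ < |x τ - y τ| := by
  by_contra! hcon
  rw [dist_eq_norm] at h
  exact h.not_ge (lp.norm_le_of_forall_le hδ fun τ => hcon τ)

/-- A law on `ℓ^∞(T)` all of whose one-dimensional projections are centred normal is the law of a
centred Gaussian process. -/
theorem isCentredGaussianLaw_of_map_eq_gaussianReal {T : Type*} {ν : Measure (LInfty T)}
    (h : ∀ D : LInfty T →L[ℝ] ℝ, ∃ v, ν.map D = gaussianReal 0 v) : IsCentredGaussianLaw ν := by
  refine ⟨⟨fun I => ⟨isGaussian_of_map_eq_gaussianReal fun L => ?_⟩⟩, fun τ => ?_⟩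
  · let R : LInfty T →L[ℝ] (I → ℝ) :=
      ContinuousLinearMap.pi fun τ => lp.evalCLM ℝ (fun _ : T => ℝ) ∞ (τ : T)
    obtain ⟨v, hv⟩ := h (L ∘L R)
    refine ⟨0, v, ?_⟩
    have hR : (fun z : LInfty T => I.restrict fun τ => z τ) = R := rfl
    rw [hR, Measure.map_map L.continuous.measurable R.continuous.measurable, ← hv]
    rfl
  · obtain ⟨v, hv⟩ := h (lp.evalCLM ℝ (fun _ : T => ℝ) ∞ τ)
    have h1 : ∫ x, id x ∂(ν.map (lp.evalCLM ℝ (fun _ : T => ℝ) ∞ τ)) = 0 := by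
      rw [hv]
      exact integral_id_gaussianReal
    rw [integral_map (ContinuousLinearMap.continuous _).measurable.aemeasurable
      aestronglyMeasurable_id] at h1
    exact h1

theorem exists_map_multivariateGaussian_eq {k : ℕ} (S : Matrix (Fin k) (Fin k) ℝ)
    (D : EuclideanSpace ℝ (Fin k) →L[ℝ] ℝ) :
    ∃ v, (multivariateGaussian 0 S).map D = gaussianReal 0 v := by
  refine ⟨(Var[D; multivariateGaussian 0 S]).toNNReal, ?_⟩
  rw [IsGaussian.map_eq_gaussianReal D]
  congr 1
  rw [ContinuousLinearMap.integral_comp_id_comm IsGaussian.integrable_id,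
    integral_id_multivariateGaussian, map_zero]

/-- A sequence of maps into `ℓ^∞(T)` which is uniformly approximated in probability by pullbacks of
finite dimensional vectors with centred normal limits converges weakly to a tight centred Gaussian
law. -/
theorem exists_gaussian_weakConvergesTo {Ω T : Type*} [MeasurableSpace Ω] {P : Measure Ω}
    [IsProbabilityMeasure P] {U : ℕ → Ω → LInfty T} {k : ℕ → ℕ} (idx : ∀ q, T → Fin (k q))
    (Z : ∀ q, ℕ → Ω → EuclideanSpace ℝ (Fin (k q))) (hZm : ∀ q n, Measurable (Z q n))
    (S : ∀ q, Matrix (Fin (k q)) (Fin (k q)) ℝ)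
    (hZ : ∀ q, TendstoInDistribution (Z q) atTop
      (id : EuclideanSpace ℝ (Fin (k q)) → EuclideanSpace ℝ (Fin (k q))) (fun _ => P)
      (multivariateGaussian 0 (S q)))
    (happrox : ∀ δ : ℝ, 0 < δ → ∀ η : ℝ≥0∞, 0 < η → ∃ q₀, ∀ q, q₀ ≤ q →
      ∀ᶠ n in atTop, P {ω | ∃ τ, δ < |U n ω τ - Z q n ω (idx q τ)|} ≤ η) :
    ∃ ν : Measure (LInfty T), IsProbabilityMeasure ν ∧ IsTightMeasureSet {ν} ∧
      IsCentredGaussianLaw ν ∧ WeakConvergesTo P U ν := by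
  have hJ : ∀ q, Continuous (LInfty.pullback (idx q)) := fun q => ContinuousLinearMap.continuous _
  have hprob : ∀ q, IsProbabilityMeasure
      ((multivariateGaussian 0 (S q)).map (LInfty.pullback (idx q))) := fun q =>
    Measure.isProbabilityMeasure_map (hJ q).measurable.aemeasurable
  let ν : ℕ → ProbabilityMeasure (LInfty T) := fun q =>
    ⟨(multivariateGaussian 0 (S q)).map (LInfty.pullback (idx q)), hprob q⟩
  have hVm : ∀ q n, Measurable fun ω => LInfty.pullback (idx q) (Z q n ω) := fun q n =>
    (hJ q).measurable.comp (hZm q n)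
  obtain ⟨ν', l, hl, hlim, htight, hweak⟩ := exists_weakConvergesTo_of_approx (P := P) (U := U)
    (V := fun q n ω => LInfty.pullback (idx q) (Z q n ω)) (ν := ν) hVm
    (fun q => by
      have := ((hZ q).continuous_comp (hJ q)).tendsto
      simp only [Function.comp_id] at this
      exact this)
    (fun q => by
      have := (isTightMeasureSet_singleton (μ := multivariateGaussian 0 (S q))).map (hJ q)
      rw [Set.image_singleton] at this
      exact this)
    (fun δ hδ η hη => by
      obtain ⟨q₀, hq₀⟩ := happrox δ hδ η hη
      refine ⟨q₀, fun q hq => (hq₀ q hq).mono fun n hn => (measure_mono fun ω hω => ?_).trans hn⟩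
      exact LInfty.exists_lt_abs_of_lt_dist hδ.le hω)
  refine ⟨ν', inferInstance, htight, isCentredGaussianLaw_of_map_eq_gaussianReal fun D => ?_,
    hweak⟩
  -- Under each `ν q`, the functional `D` is a linear functional of a normal vector, hence centred
  -- normal; this persists in the weak limit.
  have hD := ProbabilityMeasure.tendsto_map_of_tendsto_of_continuous _ _ hlim D.continuous
  refine exists_eq_gaussianReal_of_tendsto (fun q => ?_) hD
  obtain ⟨v, hv⟩ := exists_map_multivariateGaussian_eq (S q) (D ∘L LInfty.pullback (idx q))
  refine ⟨v, ?_⟩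
  rw [← hv]
  exact Measure.map_map D.continuous.measurable (hJ q).measurable

/-! ### Block sums of a stationary process -/

section CentredSum

variable {Ω 𝓧 : Type*} [MeasurableSpace 𝓧]

/-- `∑_{a < i ≤ b} (f(X_i) - μ f)`. -/
def centredSum (X : ℕ → Ω → 𝓧) (μ : Measure 𝓧) (f : 𝓧 → ℝ) (a b : ℕ) (ω : Ω) : ℝ :=
  ∑ i ∈ Finset.Ioc a b, (f (X i ω) - ∫ x, f x ∂μ)

variable {X : ℕ → Ω → 𝓧} {μ : Measure 𝓧} {f g : 𝓧 → ℝ} {a b c : ℕ}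

@[simp]
theorem centredSum_self (ω : Ω) : centredSum X μ f a a ω = 0 := by simp [centredSum]

theorem centredSum_add_adjacent (hab : a ≤ b) (hbc : b ≤ c) (ω : Ω) :
    centredSum X μ f a b ω + centredSum X μ f b c ω = centredSum X μ f a c ω :=
  Finset.sum_Ioc_consecutive _ hab hbc

theorem centredSum_sub (hf : Integrable f μ) (hg : Integrable g μ) (ω : Ω) :
    centredSum X μ (f - g) a b ω = centredSum X μ f a b ω - centredSum X μ g a b ω := by
  simp only [centredSum, ← Finset.sum_sub_distrib, Pi.sub_apply, integral_sub hf hg]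
  exact Finset.sum_congr rfl fun _ _ => by ring

theorem centredSum_shift (ω : Ω) :
    centredSum X μ f a (a + b) ω = ∑ i ∈ Finset.Icc 1 b, (f (X (i + a) ω) - ∫ x, f x ∂μ) := by
  rw [centredSum]
  symm
  refine Finset.sum_bij (fun i _ => i + a) ?_ ?_ ?_ (fun _ _ => rfl)
  · intro i hi
    simp only [Finset.mem_Icc, Finset.mem_Ioc] at hi ⊢
    omega
  · intro i _ j _ h
    omega
  · intro i hi
    simp only [Finset.mem_Ioc] at hi
    exact ⟨i - a, by simp only [Finset.mem_Icc]; omega, by omega⟩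

theorem seqEmpirical_eq_centredSum (n : ℕ) (t : ℝ) (ω : Ω) :
    seqEmpirical X μ n f t ω = (1 / √(n : ℝ)) * centredSum X μ f 0 ⌊(n : ℝ) * t⌋₊ ω := rfl

variable [MeasurableSpace Ω] {P : Measure Ω}

theorem measurable_centredSum (hX : ∀ i, Measurable (X i)) (hf : Measurable f) :
    Measurable (centredSum X μ f a b) :=
  Finset.measurable_sum _ fun i _ => (hf.comp (hX i)).sub_const _

/-- Block sums of a stationary process have shift invariant moments. -/
theorem IsStationary.integral_centredSum_pow (hstat : IsStationary X P) (hf : Measurable f)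
    (a m j : ℕ) :
    ∫ ω, centredSum X μ f a (a + m) ω ^ j ∂P =
      ∫ ω, (∑ i ∈ Finset.Icc 1 m, (f (X i ω) - ∫ x, f x ∂μ)) ^ j ∂P := by
  have hu : Measurable fun x : ℕ → 𝓧 => (∑ i ∈ Finset.Icc 1 m, (f (x i) - ∫ x, f x ∂μ)) ^ j :=
    (Finset.measurable_sum _ fun i _ => (hf.comp (measurable_pi_apply i)).sub_const _).pow_const j
  have := ((hstat a).comp hu).integral_eq
  simp only [Function.comp_def] at this
  rw [← this]
  simp only [centredSum_shift]

theorem IsStationary.map_eq (hstat : IsStationary X P) (hμ : P.map (X 0) = μ) (i : ℕ) :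
    P.map (X i) = μ := by
  have := ((hstat i).comp (measurable_pi_apply (X := fun _ : ℕ => 𝓧) 0)).map_eq
  simp only [Function.comp_def, zero_add] at this
  rw [← hμ]
  exact this

theorem IsStationary.ae_comp (hstat : IsStationary X P) (hX : ∀ i, Measurable (X i))
    (hμ : P.map (X 0) = μ) {q : 𝓧 → Prop} (h : ∀ᵐ x ∂μ, q x) : ∀ᵐ ω ∂P, ∀ i, q (X i ω) := by
  rw [ae_all_iff]
  intro i
  refine ae_of_ae_map (hX i).aemeasurable ?_
  rwa [hstat.map_eq hμ i]

variable [IsProbabilityMeasure P]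

theorem integrable_centredSum_pow (hstat : IsStationary X P) (hX : ∀ i, Measurable (X i))
    (hμ : P.map (X 0) = μ) (hf : Measurable f) {M : ℝ} (hM : ∀ᵐ x ∂μ, |f x| ≤ M) (j : ℕ) :
    Integrable (fun ω => centredSum X μ f a b ω ^ j) P := by
  refine Integrable.of_bound ((measurable_centredSum hX hf).pow_const j).aestronglyMeasurable
    ((∑ i ∈ Finset.Ioc a b, (M + |∫ x, f x ∂μ|)) ^ j) ?_
  filter_upwards [hstat.ae_comp hX hμ hM] with ω hω
  rw [norm_pow]
  gcongr
  refine (Finset.abs_sum_le_sum_abs _ _).trans (Finset.sum_le_sum fun i _ => ?_)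
  exact (abs_sub _ _).trans (by gcongr; exact hω i)

/-- Markov's inequality for the even power `2p`, after stationarity has moved the block to the
origin. The bound `M` only secures integrability. -/
theorem measure_lt_abs_centredSum_le (hstat : IsStationary X P) (hX : ∀ i, Measurable (X i))
    (hμ : P.map (X 0) = μ) (hf : Measurable f) {M : ℝ} (hM : ∀ᵐ x ∂μ, |f x| ≤ M) {p : ℕ}
    {a m : ℕ} {c B : ℝ} (hc : 0 < c)
    (hB : ∫ ω, (∑ i ∈ Finset.Icc 1 m, (f (X i ω) - ∫ x, f x ∂μ)) ^ (2 * p) ∂P ≤ B * c ^ (2 * p)) :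
    P {ω | c < |centredSum X μ f a (a + m) ω|} ≤ ENNReal.ofReal B := by
  have hcp : 0 < c ^ (2 * p) := by positivity
  have hmk := mul_meas_ge_le_integral_of_nonneg
    (ae_of_all P fun ω => (even_two_mul p).pow_nonneg (centredSum X μ f a (a + m) ω))
    (integrable_centredSum_pow hstat hX hμ hf hM (2 * p)) (c ^ (2 * p))
  rw [hstat.integral_centredSum_pow hf] at hmk
  have hreal : P.real {ω | c ^ (2 * p) ≤ centredSum X μ f a (a + m) ω ^ (2 * p)} ≤ B := by
    have := hmk.trans hB
    rw [mul_comm] at this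
    exact le_of_mul_le_mul_right this hcp
  refine (measure_mono fun ω (hω : c < _) => ?_).trans
    ((ENNReal.le_ofReal_iff_toReal_le (measure_ne_top _ _)
      (measureReal_nonneg.trans hreal)).2 hreal)
  change c ^ (2 * p) ≤ _
  rw [← (even_two_mul p).pow_abs (centredSum X μ f a (a + m) ω)]
  gcongr

end CentredSum

/-! ### Exponent arithmetic -/

/-- One summand of the moment bound at scale `x = 2^k`, with `y` standing for block length times
norm. The exponent in `hγ` leaves the excess `x^(2(p-i))`, which `x² ≤ L n` turns into the missing
power `n^(p-i)`. -/
theorem moment_term_le {x y w n A L c₀ γ r θ : ℝ} {i p : ℕ} (hx : 1 ≤ x) (hn : 0 ≤ n)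
    (hA : 1 ≤ A) (hL : 1 ≤ L) (hi : i ≤ p) (hy : 0 ≤ y) (hyn : y ≤ A * n / x) (hw : 0 ≤ w)
    (hwγ : w ≤ c₀ * x ^ γ) (hc₀ : 0 ≤ c₀) (hγ : γ ≤ 2 * (p : ℝ) - ((i : ℝ) + r + 2) - θ)
    (hxL : x ^ 2 ≤ L * n) :
    y ^ i * w ≤ (A ^ p * L ^ p * c₀) * x ^ (-(r + 2)) * (x ^ (-θ) * n ^ p) := by
  have hx0 : 0 < x := by linarith
  have hexp : x ^ (2 * (p : ℝ) - ((i : ℝ) + r + 2) - θ) =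
      (x ^ 2) ^ (p - i) * x ^ i * (x ^ (-(r + 2)) * x ^ (-θ)) := by
    rw [← Real.rpow_add hx0, ← pow_mul, ← pow_add, ← Real.rpow_natCast, ← Real.rpow_add hx0]
    congr 1
    push_cast [hi]
    ring
  calc y ^ i * w ≤ (A * n / x) ^ i * (c₀ * x ^ (2 * (p : ℝ) - ((i : ℝ) + r + 2) - θ)) := by
        refine mul_le_mul (by gcongr) (hwγ.trans ?_) hw (by positivity)
        gcongr
    _ = A ^ i * c₀ * n ^ i * (x ^ 2) ^ (p - i) * (x ^ (-(r + 2)) * x ^ (-θ)) := by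
        rw [hexp, div_pow, mul_pow]
        field_simp
    _ ≤ A ^ p * c₀ * n ^ i * (L ^ p * n ^ (p - i)) * (x ^ (-(r + 2)) * x ^ (-θ)) := by
        have h1 : (x ^ 2) ^ (p - i) ≤ L ^ p * n ^ (p - i) :=
          calc (x ^ 2) ^ (p - i) ≤ (L * n) ^ (p - i) := by gcongr
            _ = L ^ (p - i) * n ^ (p - i) := mul_pow _ _ _
            _ ≤ L ^ p * n ^ (p - i) := by
              gcongr
              omega
        gcongr
    _ = (A ^ p * L ^ p * c₀) * x ^ (-(r + 2)) * (x ^ (-θ) * n ^ p) := by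
        rw [show n ^ p = n ^ i * n ^ (p - i) by rw [← pow_add]; congr 1; omega]
        ring

/-- Here `ε x` lies in `(1/2, 1)`, and `ε^r = (ε x)^r x^(-r)`; the absolute value of `r` covers both
signs. -/
theorem rpow_ge_of_mem_dyadic_Ioo {x ε : ℝ} (hx : 0 < x) (r : ℝ)
    (hε : ε ∈ Set.Ioo ((2 * x)⁻¹) x⁻¹) : (1 / 2 : ℝ) ^ |r| * x ^ (-r) ≤ ε ^ r := by
  have hε0 : 0 < ε := lt_trans (by positivity) hε.1
  have hu1 : ε * x ≤ 1 := by
    have := mul_le_mul_of_nonneg_right hε.2.le hx.le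
    rwa [inv_mul_cancel₀ hx.ne'] at this
  have hu2 : 1 / 2 ≤ ε * x := by
    have := mul_le_mul_of_nonneg_right hε.1.le hx.le
    rwa [mul_inv, mul_assoc, inv_mul_cancel₀ hx.ne', mul_one, ← one_div] at this
  have hsplit : ε ^ r = (ε * x) ^ r * x ^ (-r) := by
    rw [Real.mul_rpow hε0.le hx.le, mul_assoc, ← Real.rpow_add hx, add_neg_cancel,
      Real.rpow_zero, mul_one]
  rw [hsplit]
  gcongr
  calc (1 / 2 : ℝ) ^ |r| ≤ (ε * x) ^ |r| := by gcongr
    _ ≤ (ε * x) ^ r := Real.rpow_le_rpow_of_exponent_ge (by positivity) hu1 (le_abs_self r)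

/-! ### Dyadic form of the bracketing integral -/

section Entropy

variable {𝓧 : Type*} [MeasurableSpace 𝓧] {C : Submodule ℝ (𝓧 → ℝ)}

/-- A class with finite bracketing number has a finite bracketing cover of that cardinality. -/
theorem exists_finset_cover {normC : Seminorm ℝ C} {G : Set C} {μ : Measure 𝓧} {s : ℝ≥0∞}
    {ε A : ℝ} {F : Set (𝓧 → ℝ)} (h : bracketingNumber normC G μ s ε A F ≠ ⊤) :
    ∃ S : Finset (C × C), (∀ b ∈ S, IsBracket normC G μ s ε A b.1 b.2) ∧
      (∀ f ∈ F, ∃ b ∈ S, ∀ x, (b.1 : 𝓧 → ℝ) x ≤ f x ∧ f x ≤ (b.2 : 𝓧 → ℝ) x) ∧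
      (S.card : ℕ∞) ≤ bracketingNumber normC G μ s ε A F := by
  have hlt : bracketingNumber normC G μ s ε A F < bracketingNumber normC G μ s ε A F + 1 :=
    (ENat.lt_add_one_iff h).2 le_rfl
  conv_lhs at hlt => rw [bracketingNumber]
  simp only [iInf_lt_iff] at hlt
  obtain ⟨S, hS, hSF, hcard⟩ := hlt
  rw [ENat.lt_add_one_iff h] at hcard
  have hfin : S.Finite := Set.encard_lt_top_iff.1 (hcard.trans_lt (lt_top_iff_ne_top.2 h))
  lift S to Finset (C × C) using hfin
  exact ⟨S, hS, hSF, by rwa [Set.encard_coe_eq_coe_finsetCard] at hcard⟩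

/-- For `ε` between `2^(-k-1)` and `2^(-k)` the supremum includes `δ = 2^(-k)`, so no monotonicity
of the bracketing numbers is needed. The weight is the interval length times a lower bound for
`ε^r`. -/
theorem tsum_bracketingNumber_le (normC : Seminorm ℝ C) (G : Set C) (μ : Measure 𝓧) (s : ℝ≥0∞)
    (r : ℝ) (Ψ : ℝ → ℝ) (F : Set (𝓧 → ℝ)) :
    ∑' k : ℕ, ENNReal.ofReal ((1 / 2 : ℝ) ^ |r| / 2 * ((2 : ℝ) ^ k) ^ (-(r + 1))) *
      ((bracketingNumber normC G μ s ((2 : ℝ) ^ k)⁻¹ (Ψ ((2 : ℝ) ^ k)) F : ℕ∞) : ℝ≥0∞) ^ 2 ≤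
    bracketingIntegral normC G μ s r Ψ F := by
  set N : ℕ → ℝ≥0∞ := fun k =>
    ((bracketingNumber normC G μ s ((2 : ℝ) ^ k)⁻¹ (Ψ ((2 : ℝ) ^ k)) F : ℕ∞) : ℝ≥0∞) ^ 2 with hN
  let d : ℕ → ℝ := fun k => ((2 : ℝ) ^ k)⁻¹
  have hd : Antitone d := fun i j hij => by
    simp only [d]
    gcongr
    norm_num
  have hdisj := hd.pairwise_disjoint_on_Ioo_succ
  rw [bracketingIntegral]
  calc _ ≤ ∑' k, ∫⁻ ε in Set.Ioo (d (Order.succ k)) (d k), ENNReal.ofReal (ε ^ r) *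
        ⨆ δ ∈ Set.Icc ε 1,
          ((bracketingNumber normC G μ s δ (Ψ δ⁻¹) F : ℕ∞) : ℝ≥0∞) ^ 2 := by
        refine ENNReal.tsum_le_tsum fun k => ?_
        have hx : (0 : ℝ) < 2 ^ k := by positivity
        have hdk : d (Order.succ k) = (2 * 2 ^ k)⁻¹ := by
          simp only [d, Order.succ_eq_add_one, pow_succ, mul_comm]
        calc _ = ∫⁻ _ in Set.Ioo (d (Order.succ k)) (d k),
              ENNReal.ofReal ((1 / 2 : ℝ) ^ |r| * ((2 : ℝ) ^ k) ^ (-r)) * N k := by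
              rw [setLIntegral_const, Real.volume_Ioo, mul_right_comm, ← ENNReal.ofReal_mul
                (by positivity)]
              congr 2
              rw [neg_add, Real.rpow_add hx, Real.rpow_neg_one, hdk]
              simp only [d]
              field_simp
              norm_num
          _ ≤ _ := by
              refine setLIntegral_mono' measurableSet_Ioo fun ε hε => ?_
              gcongr
              · exact rpow_ge_of_mem_dyadic_Ioo hx r (by rwa [hdk] at hε)
              · have hmem : d k ∈ Set.Icc ε 1 :=
                  ⟨hε.2.le, inv_le_one_of_one_le₀ (one_le_pow₀ one_le_two)⟩
                refine le_trans ?_ (le_iSup₂ (f := fun δ (_ : δ ∈ Set.Icc ε 1) =>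
                  ((bracketingNumber normC G μ s δ (Ψ δ⁻¹) F : ℕ∞) : ℝ≥0∞) ^ 2) (d k) hmem)
                simp only [hN, d, inv_inv, le_refl]
    _ = ∫⁻ ε in ⋃ k, Set.Ioo (d (Order.succ k)) (d k), ENNReal.ofReal (ε ^ r) *
        ⨆ δ ∈ Set.Icc ε 1,
          ((bracketingNumber normC G μ s δ (Ψ δ⁻¹) F : ℕ∞) : ℝ≥0∞) ^ 2 :=
        (lintegral_iUnion (fun _ => measurableSet_Ioo) hdisj _).symm
    _ ≤ _ := by
        refine lintegral_mono_set (Set.iUnion_subset fun k ε hε => ⟨?_, ?_⟩)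
        · exact lt_trans (by positivity) hε.1
        · exact hε.2.trans_le (inv_le_one_of_one_le₀ (one_le_pow₀ one_le_two))

/-- Finiteness of the bracketing integral yields dyadic bracketing covers whose squared
cardinalities are summable against the corresponding weights. -/
theorem exists_dyadic_covers {normC : Seminorm ℝ C} {G : Set C} {μ : Measure 𝓧} {s : ℝ≥0∞}
    {r : ℝ} {Ψ : ℝ → ℝ} {F : Set (𝓧 → ℝ)} (h : bracketingIntegral normC G μ s r Ψ F < ∞) :
    ∃ S : ℕ → Finset (C × C),
      (∀ k, ∀ b ∈ S k, IsBracket normC G μ s ((2 : ℝ) ^ k)⁻¹ (Ψ ((2 : ℝ) ^ k)) b.1 b.2) ∧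
      (∀ k, ∀ f ∈ F, ∃ b ∈ S k, ∀ x, (b.1 : 𝓧 → ℝ) x ≤ f x ∧ f x ≤ (b.2 : 𝓧 → ℝ) x) ∧
      Summable fun k => ((2 : ℝ) ^ k) ^ (-(r + 1)) * ((S k).card : ℝ) ^ 2 := by
  have hsum := ((tsum_bracketingNumber_le normC G μ s r Ψ F).trans_lt h).ne
  have hcpos : 0 < (1 / 2 : ℝ) ^ |r| / 2 := by positivity
  have hfin : ∀ k : ℕ,
      bracketingNumber normC G μ s ((2 : ℝ) ^ k)⁻¹ (Ψ ((2 : ℝ) ^ k)) F ≠ ⊤ := by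
    intro k htop
    refine ENNReal.ne_top_of_tsum_ne_top hsum k ?_
    rw [htop, ENat.toENNReal_top, ENNReal.top_pow two_ne_zero, ENNReal.mul_top]
    rw [Ne, ENNReal.ofReal_eq_zero, not_le]
    positivity
  choose S hS hSF hcard using fun k => exists_finset_cover (hfin k)
  refine ⟨S, hS, hSF, ?_⟩
  have h1 : ∑' k : ℕ, ENNReal.ofReal ((1 / 2 : ℝ) ^ |r| / 2 * ((2 : ℝ) ^ k) ^ (-(r + 1))) *
      ((S k).card : ℝ≥0∞) ^ 2 ≠ ∞ := by
    refine ne_top_of_le_ne_top hsum (ENNReal.tsum_le_tsum fun k => ?_)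
    gcongr
    exact_mod_cast ENat.toENNReal_le.2 (hcard k)
  have h2 := (ENNReal.summable_toReal h1).mul_left ((1 / 2 : ℝ) ^ |r| / 2)⁻¹
  refine h2.congr fun k => ?_
  rw [ENNReal.toReal_mul, ENNReal.toReal_ofReal (by positivity), ENNReal.toReal_pow,
    ENNReal.toReal_natCast]
  field_simp

end Entropy

/-! ### Dyadic times -/

section Grid

/-- The number of observations up to the dyadic time `j / 2^k`. -/
def grid (n k j : ℕ) : ℕ := n * j / 2 ^ k

theorem grid_half_le (n k j : ℕ) : grid n k (j / 2) ≤ grid n (k + 1) j := by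
  rw [grid, grid, Nat.le_div_iff_mul_le (by positivity)]
  calc n * (j / 2) / 2 ^ k * 2 ^ (k + 1) = (n * (j / 2) / 2 ^ k * 2 ^ k) * 2 := by ring
    _ ≤ (n * (j / 2)) * 2 := Nat.mul_le_mul_right _ (Nat.div_mul_le_self _ _)
    _ = n * (j / 2 * 2) := by ring
    _ ≤ n * j := by gcongr; exact Nat.div_mul_le_self _ _

theorem grid_le {n k j : ℕ} (hj : j ≤ 2 ^ k) : grid n k j ≤ n := by
  rw [grid]
  refine Nat.div_le_of_le_mul ?_
  rw [mul_comm]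
  gcongr

theorem grid_cast_le (n k j : ℕ) : (grid n k j : ℝ) ≤ n * j / 2 ^ k := by
  have := Nat.cast_div_le (α := ℝ) (m := n * j) (n := 2 ^ k)
  push_cast at this
  exact this

theorem grid_cast_gt (n k j : ℕ) : (n * j / 2 ^ k : ℝ) - 1 < grid n k j := by
  have := Nat.sub_one_lt_floor ((n * j : ℕ) / (2 ^ k : ℕ) : ℝ)
  rw [Nat.floor_div_eq_div] at this
  push_cast at this
  exact this

/-- The block between a dyadic time and its parent on the coarser grid; the extra `1` comes from
rounding to integers. -/
theorem grid_sub_grid_half_le (n k j : ℕ) :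
    (grid n (k + 1) j : ℝ) - grid n k (j / 2) ≤ n / 2 ^ (k + 1) + 1 := by
  have h1 := grid_cast_le n (k + 1) j
  have h2 := grid_cast_gt n k (j / 2)
  have h3 : (j : ℝ) ≤ 2 * ((j / 2 : ℕ) : ℝ) + 1 := by exact_mod_cast (by omega : j ≤ 2 * (j / 2) + 1)
  have h4 : (n * j / 2 ^ (k + 1) : ℝ) ≤ n * (j / 2 : ℕ) / 2 ^ k + n / 2 ^ (k + 1) := by
    rw [show (n * (j / 2 : ℕ) / 2 ^ k + n / 2 ^ (k + 1) : ℝ) =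
      n * (2 * ((j / 2 : ℕ) : ℝ) + 1) / 2 ^ (k + 1) by rw [pow_succ]; field_simp]
    gcongr
  linarith

/-- The approximations of `t` from below form a chain of parents, so a link depends on `t` only
through its finer index. -/
theorem floor_two_pow_succ_mul_half (k : ℕ) (t : ℝ) :
    ⌊(2 : ℝ) ^ (k + 1) * t⌋₊ / 2 = ⌊(2 : ℝ) ^ k * t⌋₊ := by
  rw [← Nat.floor_div_ofNat, pow_succ]
  congr 1
  ring

theorem floor_two_pow_mul_le {t : ℝ} (ht1 : t ≤ 1) (k : ℕ) : ⌊(2 : ℝ) ^ k * t⌋₊ ≤ 2 ^ k := by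
  refine Nat.floor_le_of_le ?_
  push_cast
  exact mul_le_of_le_one_right (by positivity) ht1

theorem floor_mul_dyadic (n k j : ℕ) : ⌊(n : ℝ) * ((j : ℝ) / 2 ^ k)⌋₊ = grid n k j := by
  rw [grid, ← Nat.floor_div_eq_div (K := ℝ)]
  push_cast
  congr 1
  ring

theorem grid_floor_le {t : ℝ} (ht0 : 0 ≤ t) (n k : ℕ) :
    grid n k ⌊(2 : ℝ) ^ k * t⌋₊ ≤ ⌊(n : ℝ) * t⌋₊ := by
  refine Nat.le_floor ((grid_cast_le _ _ _).trans ?_)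
  rw [div_le_iff₀ (by positivity)]
  calc (n : ℝ) * ⌊(2 : ℝ) ^ k * t⌋₊ ≤ n * (2 ^ k * t) := by
        gcongr
        exact Nat.floor_le (by positivity)
    _ = _ := by ring

theorem floor_sub_grid_floor_le {t : ℝ} (ht0 : 0 ≤ t) (n k : ℕ) :
    (⌊(n : ℝ) * t⌋₊ : ℝ) - grid n k ⌊(2 : ℝ) ^ k * t⌋₊ ≤ n / 2 ^ k + 1 := by
  have h1 : (⌊(n : ℝ) * t⌋₊ : ℝ) ≤ n * t := Nat.floor_le (by positivity)
  have h2 := grid_cast_gt n k ⌊(2 : ℝ) ^ k * t⌋₊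
  have h3 : (2 : ℝ) ^ k * t ≤ ⌊(2 : ℝ) ^ k * t⌋₊ + 1 := (Nat.lt_floor_add_one _).le
  have h4 : (n * t : ℝ) ≤ n * ⌊(2 : ℝ) ^ k * t⌋₊ / 2 ^ k + n / 2 ^ k := by
    rw [← add_div, le_div_iff₀ (by positivity)]
    calc (n * t * 2 ^ k : ℝ) = n * (2 ^ k * t) := by ring
      _ ≤ n * (⌊(2 : ℝ) ^ k * t⌋₊ + 1) := by gcongr
      _ = _ := by ring
  linarith

end Grid

/-! ### The final link of a chain -/

section Bracket

variable {Ω 𝓧 : Type*} [MeasurableSpace 𝓧]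

/-- Comparison of the partial sums of a function with those of the lower end of a bracket around
it, at an earlier time. -/
theorem abs_centredSum_sub_le_of_bracket {X : ℕ → Ω → 𝓧} {μ : Measure 𝓧} [IsProbabilityMeasure μ]
    {f l u : 𝓧 → ℝ} (hf : Integrable f μ) (hl : Integrable l μ) (hu : Integrable u μ)
    (hlf : ∀ x, l x ≤ f x) (hfu : ∀ x, f x ≤ u x) {M : ℝ}
    (hlM : ∀ᵐ x ∂μ, |l x| ≤ M) (huM : ∀ᵐ x ∂μ, |u x| ≤ M) {ω : Ω}
    (hlω : ∀ i, |l (X i ω)| ≤ M) (huω : ∀ i, |u (X i ω)| ≤ M) {m' m : ℕ} (hm : m' ≤ m) :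
    |centredSum X μ f 0 m ω - centredSum X μ l 0 m' ω| ≤
      ((m : ℝ) - m') * (2 * M) + |centredSum X μ (u - l) 0 m' ω| + m' * ∫ x, (u - l) x ∂μ := by
  have hfM : ∀ x, |l x| ≤ M → |u x| ≤ M → |f x| ≤ M := fun x h1 h2 =>
    abs_le.2 ⟨(abs_le.1 h1).1.trans (hlf x), (hfu x).trans (abs_le.1 h2).2⟩
  have hμf : |∫ x, f x ∂μ| ≤ M := by
    have := norm_integral_le_of_norm_le_const (μ := μ) (f := f) (C := M)
      (by filter_upwards [hlM, huM] with x h1 h2 using hfM x h1 h2)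
    simpa using this
  have hblock : |centredSum X μ f m' m ω| ≤ ((m : ℝ) - m') * (2 * M) := by
    refine (Finset.abs_sum_le_sum_abs _ _).trans ?_
    calc ∑ i ∈ Finset.Ioc m' m, |f (X i ω) - ∫ x, f x ∂μ| ≤ ∑ _i ∈ Finset.Ioc m' m, 2 * M :=
          Finset.sum_le_sum fun i _ => (abs_sub _ _).trans (by
            linarith [hfM _ (hlω i) (huω i)])
      _ = ((m : ℝ) - m') * (2 * M) := by
          rw [Finset.sum_const, Nat.card_Ioc, nsmul_eq_mul, Nat.cast_sub hm]
  have hfl : ∫ x, (f - l) x ∂μ ≤ ∫ x, (u - l) x ∂μ :=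
    integral_mono (hf.sub hl) (hu.sub hl) fun x => sub_le_sub_right (hfu x) _
  have hfl0 : 0 ≤ ∫ x, (f - l) x ∂μ := integral_nonneg fun x => sub_nonneg.2 (hlf x)
  -- The uncentred sum of `f - l` lies between `0` and that of `u - l`; centring costs at most `m'`
  -- times the mean of `u - l`.
  have hdiff : |centredSum X μ (f - l) 0 m' ω| ≤
      |centredSum X μ (u - l) 0 m' ω| + m' * ∫ x, (u - l) x ∂μ := by
    have expand : ∀ g : 𝓧 → ℝ, centredSum X μ g 0 m' ω =
        ∑ i ∈ Finset.Ioc 0 m', g (X i ω) - m' * ∫ x, g x ∂μ := fun g => by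
      simp [centredSum, Finset.sum_sub_distrib]
    have hs0 : 0 ≤ ∑ i ∈ Finset.Ioc 0 m', (f - l) (X i ω) :=
      Finset.sum_nonneg fun i _ => sub_nonneg.2 (hlf _)
    have hs1 : ∑ i ∈ Finset.Ioc 0 m', (f - l) (X i ω) ≤ ∑ i ∈ Finset.Ioc 0 m', (u - l) (X i ω) :=
      Finset.sum_le_sum fun i _ => sub_le_sub_right (hfu _) _
    have hm0 : (0 : ℝ) ≤ m' := Nat.cast_nonneg _
    have e1 := expand (f - l)
    have e2 := expand (u - l)
    have p1 := mul_le_mul_of_nonneg_left hfl hm0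
    have p2 := mul_nonneg hm0 hfl0
    rw [abs_le]
    constructor
    · linarith [abs_nonneg (centredSum X μ (u - l) 0 m' ω)]
    · linarith [le_abs_self (centredSum X μ (u - l) 0 m' ω)]
  rw [centredSum_sub hf hl] at hdiff
  rw [← centredSum_add_adjacent (f := f) (Nat.zero_le m') hm]
  calc |centredSum X μ f 0 m' ω + centredSum X μ f m' m ω - centredSum X μ l 0 m' ω|
      = |centredSum X μ f m' m ω + (centredSum X μ f 0 m' ω - centredSum X μ l 0 m' ω)| := by
        congr 1
        ring
    _ ≤ _ := (abs_add_le _ _).trans (by linarith)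

end Bracket

/-! ### Tail bounds from the moment condition -/

section Setting

variable {Ω 𝓧 : Type*} [MeasurableSpace Ω] [MeasurableSpace 𝓧] {C : Submodule ℝ (𝓧 → ℝ)}

/-- A stationary process and a class `G ⊆ C` of functions bounded by `M` satisfying the moment
bounds. -/
structure MomentSetting (X : ℕ → Ω → 𝓧) (P : Measure Ω) (μ : Measure 𝓧) (normC : Seminorm ℝ C)
    (G : Set C) (p : ℕ) (s : ℝ≥0∞) (Φ : ℕ → ℝ → ℝ) (M : ℝ) : Prop where
  meas : ∀ i, Measurable (X i)
  stat : IsStationary X P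
  map : P.map (X 0) = μ
  measC : ∀ g ∈ C, Measurable g
  one_le : 1 ≤ s
  one_le_bound : 1 ≤ M
  bound : ∀ g ∈ G, ∀ᵐ x ∂μ, |(g : 𝓧 → ℝ) x| ≤ M
  mono : ∀ i ∈ Finset.Icc 1 p, MonotoneOn (Φ i) (Set.Ici 0)
  nonneg : ∀ i ∈ Finset.Icc 1 p, ∀ x, 0 ≤ x → 0 ≤ Φ i x
  moment : MomentBound X P μ normC G p s Φ

variable {X : ℕ → Ω → 𝓧} {P : Measure Ω} {μ : Measure 𝓧}
  {normC : Seminorm ℝ C} {G : Set C} {p : ℕ} {s : ℝ≥0∞} {Φ : ℕ → ℝ → ℝ} {M : ℝ}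

namespace MomentSetting

theorem bound_union (h : MomentSetting X P μ normC G p s Φ M) {g : C} (hg : g ∈ G ∪ (G - G)) :
    ∀ᵐ x ∂μ, |(g : 𝓧 → ℝ) x| ≤ 2 * M := by
  have hM := h.one_le_bound
  rcases hg with hg | hg
  · filter_upwards [h.bound g hg] with x hx
    linarith
  · obtain ⟨g₁, h₁, g₂, h₂, rfl⟩ := Set.mem_sub.1 hg
    filter_upwards [h.bound g₁ h₁, h.bound g₂ h₂] with x hx₁ hx₂
    have := abs_sub ((g₁ : 𝓧 → ℝ) x) ((g₂ : 𝓧 → ℝ) x)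
    simp only [AddSubgroupClass.coe_sub, Pi.sub_apply]
    linarith

variable [IsProbabilityMeasure P]

theorem isProbabilityMeasure (h : MomentSetting X P μ normC G p s Φ M) :
    IsProbabilityMeasure μ := by
  rw [← h.map]
  exact Measure.isProbabilityMeasure_map (h.meas 0).aemeasurable

theorem integrable (h : MomentSetting X P μ normC G p s Φ M) {g : C} (hg : g ∈ G ∪ (G - G)) :
    Integrable (g : 𝓧 → ℝ) μ := by
  have := h.isProbabilityMeasure
  exact Integrable.of_bound (h.measC g g.2).aestronglyMeasurable _ (h.bound_union hg)

theorem toReal_eLpNorm_le (h : MomentSetting X P μ normC G p s Φ M) {g : C} (hg : g ∈ G) :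
    (eLpNorm (g : 𝓧 → ℝ) s μ).toReal ≤ M := by
  have := h.isProbabilityMeasure
  have h1 := eLpNorm_le_of_ae_bound (f := (g : 𝓧 → ℝ)) (p := s) (h.bound g hg)
  rw [measure_univ, ENNReal.one_rpow, one_mul] at h1
  exact ENNReal.toReal_le_of_le_ofReal (zero_le_one.trans h.one_le_bound) h1

/-- Tail bound for the sum of a function of controlled norms over a block of observations. -/
theorem measure_lt_abs_centredSum_le (h : MomentSetting X P μ normC G p s Φ M) {g : C}
    (hg : g ∈ G ∪ (G - G)) {a b n : ℕ} (hab : a ≤ b) {x y A L c₀ r θ η c : ℝ} {γ : ℕ → ℝ}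
    (hx : 1 ≤ x) (hA : 1 ≤ A) (hL : 1 ≤ L) (hc₀ : 0 ≤ c₀) (hη : 0 < η) (hc : 0 < c)
    (hnorm : normC g ≤ y)
    (hlen : ((b : ℝ) - a) * (eLpNorm (g : 𝓧 → ℝ) s μ).toReal ≤ A * n / x)
    (hxL : x ^ 2 ≤ L * n) (hΦ : ∀ i ∈ Finset.Icc 1 p, Φ i y ≤ c₀ * x ^ γ i)
    (hγ : ∀ i ∈ Finset.Icc 1 p, γ i ≤ 2 * (p : ℝ) - ((i : ℝ) + r + 2) - θ)
    (hcη : c ^ (2 * p) = η ^ (2 * p) * (x ^ (-θ) * (n : ℝ) ^ p)) :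
    P {ω | c < |centredSum X μ (g : 𝓧 → ℝ) a b ω|} ≤
      ENNReal.ofReal (p * (A ^ p * L ^ p * c₀) / η ^ (2 * p) * x ^ (-(r + 2))) := by
  obtain ⟨m, rfl⟩ := Nat.exists_eq_add_of_le hab
  rcases Nat.eq_zero_or_pos m with rfl | hm
  · have : {ω | c < |centredSum X μ (g : 𝓧 → ℝ) a (a + 0) ω|} = ∅ := by
      ext ω
      simp [hc.le]
    rw [this, measure_empty]
    exact zero_le
  refine SeqEmp.measure_lt_abs_centredSum_le (p := p) h.stat h.meas h.map (h.measC g g.2)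
    (h.bound_union hg) hc ((h.moment m hm g hg).trans ?_)
  have hg0 : 0 ≤ normC g := apply_nonneg _ _
  rw [Nat.cast_add, add_sub_cancel_left] at hlen
  calc ∑ i ∈ Finset.Icc 1 p, (m : ℝ) ^ i * (eLpNorm (g : 𝓧 → ℝ) s μ).toReal ^ i * Φ i (normC g)
      ≤ ∑ i ∈ Finset.Icc 1 p,
          (A ^ p * L ^ p * c₀) * x ^ (-(r + 2)) * (x ^ (-θ) * (n : ℝ) ^ p) := by
        refine Finset.sum_le_sum fun i hi => ?_
        rw [← mul_pow]
        exact moment_term_le hx (Nat.cast_nonneg n) hA hL (Finset.mem_Icc.1 hi).2 (by positivity)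
          hlen (h.nonneg i hi _ hg0)
          ((h.mono i hi hg0 (hg0.trans hnorm) hnorm).trans (hΦ i hi)) hc₀ (hγ i hi) hxL
    _ = p * ((A ^ p * L ^ p * c₀) * x ^ (-(r + 2)) * (x ^ (-θ) * (n : ℝ) ^ p)) := by
        rw [Finset.sum_const, Nat.card_Icc, nsmul_eq_mul, Nat.add_sub_cancel]
    _ = _ := by
        rw [hcη]
        field_simp

end MomentSetting

end Setting

/-! ### Links of the chain and their probabilities -/

section Chaining

variable {Ω 𝓧 : Type*} [MeasurableSpace 𝓧] {C : Submodule ℝ (𝓧 → ℝ)}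

/-- The function `f` lies in the bracket `b`. -/
def Encloses (b : C × C) (f : 𝓧 → ℝ) : Prop :=
  ∀ x, (b.1 : 𝓧 → ℝ) x ≤ f x ∧ f x ≤ (b.2 : 𝓧 → ℝ) x

/-- The event that one of the increments between the dyadic levels `k` and `k + 1` determined by
the brackets `b`, `b'` and the dyadic time `j / 2^(k+1)` exceeds `c`. -/
def stepEvent (X : ℕ → Ω → 𝓧) (μ : Measure 𝓧) (n k : ℕ) (c : ℝ) (b b' : C × C) (j : ℕ) : Set Ω :=
  ({ω | c < |centredSum X μ (b.1 : 𝓧 → ℝ) (grid n k (j / 2)) (grid n (k + 1) j) ω|} ∪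
    {ω | (∃ f, Encloses b f ∧ Encloses b' f) ∧
      c < |centredSum X μ ((b.1 - b'.1 : C) : 𝓧 → ℝ) 0 (grid n k (j / 2)) ω|}) ∪
  {ω | c < |centredSum X μ ((b.2 - b.1 : C) : 𝓧 → ℝ) 0 (grid n (k + 1) j) ω|}

/-- The union of the events `stepEvent` over all pairs of brackets in the covers `S`, `S'` and all
dyadic times. -/
def levelEvent (X : ℕ → Ω → 𝓧) (μ : Measure 𝓧) (n k : ℕ) (c : ℝ) (S S' : Finset (C × C)) : Set Ω :=
  ⋃ z ∈ S ×ˢ S' ×ˢ Finset.range (2 ^ (k + 1) + 1), stepEvent X μ n k c z.1 z.2.1 z.2.2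

/-- Passing through the common `f`, the difference of the lower ends is at most `u' - l'` from above
and `u - l` from below. -/
theorem eLpNorm_sub_le_of_encloses {μ : Measure 𝓧} {s : ℝ≥0∞} (hs : 1 ≤ s)
    (hC : ∀ g ∈ C, Measurable g) {b b' : C × C} {f : 𝓧 → ℝ} (hb : Encloses b f)
    (hb' : Encloses b' f) :
    eLpNorm ((b.1 - b'.1 : C) : 𝓧 → ℝ) s μ ≤
      eLpNorm ((b.2 : 𝓧 → ℝ) - (b.1 : 𝓧 → ℝ)) s μ +
        eLpNorm ((b'.2 : 𝓧 → ℝ) - (b'.1 : 𝓧 → ℝ)) s μ := by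
  refine le_trans (eLpNorm_mono_real fun x => ?_) (eLpNorm_add_le
    ((hC _ b.2.2).sub (hC _ b.1.2)).aestronglyMeasurable
    ((hC _ b'.2.2).sub (hC _ b'.1.2)).aestronglyMeasurable hs)
  have h1 := hb x
  have h2 := hb' x
  simp only [AddSubgroupClass.coe_sub, Pi.sub_apply, Pi.add_apply, Real.norm_eq_abs]
  rw [abs_le]
  constructor <;> linarith [h1.1, h1.2, h2.1, h2.2]

section Measure

variable [MeasurableSpace Ω]
  {X : ℕ → Ω → 𝓧} {P : Measure Ω} [IsProbabilityMeasure P] {μ : Measure 𝓧}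
  {normC : Seminorm ℝ C} {G : Set C} {p : ℕ} {s : ℝ≥0∞} {Φ : ℕ → ℝ → ℝ} {M : ℝ}

/-- With `x = 2^(k+1)`, length times norm is `O(n / x)` in all three cases: a block of length at
most `n / x + 1` with norm at most `M`, or a block of length at most `n` with norm at most `3 / x`.
The term `(1 + L) M` in the constant absorbs the rounding, as `x² ≤ L n` gives `1 ≤ L n / x`; the
`3` comes from `2^(-k-1) + 2^(-k) = 3 / x`. -/
theorem MomentSetting.measure_stepEvent_le (h : MomentSetting X P μ normC G p s Φ M)
    {Ψ : ℝ → ℝ} (hΨ : MonotoneOn Ψ (Set.Ici 0)) (hΨ0 : ∀ x, 0 ≤ x → 0 ≤ Ψ x)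
    {n k j : ℕ} {b b' : C × C}
    (hb : IsBracket normC G μ s ((2 : ℝ) ^ (k + 1))⁻¹ (Ψ (2 ^ (k + 1))) b.1 b.2)
    (hb' : IsBracket normC G μ s ((2 : ℝ) ^ k)⁻¹ (Ψ (2 ^ k)) b'.1 b'.2)
    (hj : j ≤ 2 ^ (k + 1)) {L c₀ r θ η c : ℝ} {γ : ℕ → ℝ}
    (hL : 1 ≤ L) (hc₀ : 0 ≤ c₀) (hη : 0 < η) (hc : 0 < c)
    (hxL : ((2 : ℝ) ^ (k + 1)) ^ 2 ≤ L * n)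
    (hΦ : ∀ i ∈ Finset.Icc 1 p, Φ i (2 * Ψ (2 ^ (k + 1))) ≤ c₀ * ((2 : ℝ) ^ (k + 1)) ^ γ i)
    (hγ : ∀ i ∈ Finset.Icc 1 p, γ i ≤ 2 * (p : ℝ) - ((i : ℝ) + r + 2) - θ)
    (hcη : c ^ (2 * p) = η ^ (2 * p) * (((2 : ℝ) ^ (k + 1)) ^ (-θ) * (n : ℝ) ^ p)) :
    P (stepEvent X μ n k c b b' j) ≤ 3 * ENNReal.ofReal
      (p * ((3 + (1 + L) * M) ^ p * L ^ p * c₀) / η ^ (2 * p) *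
        ((2 : ℝ) ^ (k + 1)) ^ (-(r + 2))) := by
  have hM := h.one_le_bound
  set x : ℝ := 2 ^ (k + 1) with hx
  have hx1 : 1 ≤ x := one_le_pow₀ one_le_two
  have hx0 : 0 < x := by linarith
  have hx2 : (2 : ℝ) ^ k = x / 2 := by rw [hx, pow_succ]; field_simp
  have hA : 1 ≤ 3 + (1 + L) * M := by nlinarith
  have hΨx : 0 ≤ Ψ x := hΨ0 x hx0.le
  have hΨle : Ψ (2 ^ k) ≤ Ψ x :=
    hΨ (Set.mem_Ici.2 (by positivity)) (Set.mem_Ici.2 hx0.le) (by rw [hx2]; linarith)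
  have hn1 : 1 ≤ L * n / x := by
    rw [le_div_iff₀ hx0, one_mul]
    nlinarith
  have hgrid : (grid n k (j / 2) : ℝ) ≤ n := by
    have : j / 2 ≤ 2 ^ k := by rw [pow_succ] at hj; omega
    exact_mod_cast grid_le this
  have hgrid' : (grid n (k + 1) j : ℝ) ≤ n := by exact_mod_cast grid_le hj
  have hnx : 0 ≤ (n : ℝ) / x := by positivity
  have hmain : ∀ {g : C} {a d : ℕ}, g ∈ G ∪ (G - G) → a ≤ d → normC g ≤ 2 * Ψ x →
      ((d : ℝ) - a) * (eLpNorm (g : 𝓧 → ℝ) s μ).toReal ≤ (3 + (1 + L) * M) * n / x →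
      P {ω | c < |centredSum X μ (g : 𝓧 → ℝ) a d ω|} ≤ ENNReal.ofReal
        (p * ((3 + (1 + L) * M) ^ p * L ^ p * c₀) / η ^ (2 * p) * x ^ (-(r + 2))) :=
    fun hg hab hnorm hlen => h.measure_lt_abs_centredSum_le hg hab hx1 hA hL hc₀ hη hc hnorm hlen
      hxL hΦ hγ hcη
  have hlen_of : ∀ {m : ℕ} {v : ℝ}, (m : ℝ) ≤ n → 0 ≤ v → v ≤ 3 / x →
      ((m : ℝ) - (0 : ℕ)) * v ≤ (3 + (1 + L) * M) * n / x := fun {m v} hm hv0 hv => by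
    have h1 : (m : ℝ) * v ≤ n * (3 / x) := by gcongr
    have h2 : (n : ℝ) * (3 / x) = 3 * (n / x) := by ring
    have h3 : (3 + (1 + L) * M) * n / x = 3 * (n / x) + (1 + L) * M * (n / x) := by ring
    have h4 : 0 ≤ (1 + L) * M * (n / x) := by positivity
    rw [Nat.cast_zero, sub_zero]
    linarith
  have hbound : ∀ {ι : ENNReal}, ι ≤ ENNReal.ofReal (3 / x) → ι.toReal ≤ 3 / x := fun hι =>
    ENNReal.toReal_le_of_le_ofReal (by positivity) hι
  rw [show (3 : ℝ≥0∞) = 1 + 1 + 1 by norm_num, add_mul, add_mul, one_mul]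
  refine (measure_union_le _ _).trans (add_le_add ((measure_union_le _ _).trans
    (add_le_add ?_ ?_)) ?_)
  · refine hmain (Or.inl hb.mem_left) (grid_half_le n k j) (hb.norm_left.trans (by linarith)) ?_
    have h1 := grid_sub_grid_half_le n k j
    rw [← hx] at h1
    have h2 := h.toReal_eLpNorm_le hb.mem_left
    have h3 : (0 : ℝ) ≤ (grid n (k + 1) j : ℝ) - grid n k (j / 2) :=
      sub_nonneg.2 (by exact_mod_cast grid_half_le n k j)
    calc _ ≤ ((n : ℝ) / x + 1) * M := by gcongr
      _ ≤ ((n : ℝ) / x + L * n / x) * M := by gcongr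
      _ ≤ 3 * (n / x) + ((n : ℝ) / x + L * n / x) * M := by linarith
      _ = _ := by ring
  -- Only brackets with a common function have close lower ends; for other pairs this part of the
  -- event is empty.
  · by_cases hf : ∃ f, Encloses b f ∧ Encloses b' f
    · refine (measure_mono fun ω hω => hω.2).trans (hmain
        (Or.inr (Set.sub_mem_sub hb.mem_left hb'.mem_left)) (Nat.zero_le _) ?_
        (hlen_of hgrid ENNReal.toReal_nonneg (hbound ?_)))
      · exact (map_sub_le_add normC _ _).trans (by linarith [hb.norm_left, hb'.norm_left])
      · obtain ⟨f, hbf, hbf'⟩ := hf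
        refine (eLpNorm_sub_le_of_encloses h.one_le h.measC hbf hbf').trans
          ((add_le_add hb.eLpNorm_sub_le hb'.eLpNorm_sub_le).trans ?_)
        rw [← ENNReal.ofReal_add (by positivity) (by positivity)]
        refine ENNReal.ofReal_le_ofReal (le_of_eq ?_)
        rw [hx2]
        field_simp
        norm_num
    · have : {ω | (∃ f, Encloses b f ∧ Encloses b' f) ∧
          c < |centredSum X μ ((b.1 - b'.1 : C) : 𝓧 → ℝ) 0 (grid n k (j / 2)) ω|} = ∅ := by
        ext ω
        simp [hf]
      rw [this, measure_empty]
      exact zero_le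
  · refine hmain (Or.inr (Set.sub_mem_sub hb.mem_right hb.mem_left)) (Nat.zero_le _) ?_
      (hlen_of hgrid' ENNReal.toReal_nonneg (hbound ?_))
    · exact (map_sub_le_add normC _ _).trans (by linarith [hb.norm_left, hb.norm_right])
    · rw [AddSubgroupClass.coe_sub]
      refine hb.eLpNorm_sub_le.trans (ENNReal.ofReal_le_ofReal ?_)
      rw [inv_eq_one_div]
      gcongr
      norm_num

/-- The weight of a dyadic level with a cover of cardinality `N`. -/
def levelWeight (r : ℝ) (k N : ℕ) : ℝ := ((2 : ℝ) ^ k) ^ (-(r + 1)) * (N : ℝ) ^ 2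

theorem levelWeight_nonneg (r : ℝ) (k N : ℕ) : 0 ≤ levelWeight r k N := by
  unfold levelWeight
  positivity

/-- The dyadic times cost one power of `2^(k+1)`, turning `-(r + 2)` into `-(r + 1)`, and the
product of the two cardinalities is split into squares. This is why the entropy condition has
squared bracketing numbers; `r > -1` lets the weight of level `k + 1` be replaced by that of level
`k`. -/
theorem level_count_le {r B : ℝ} (hr : -1 < r) (hB : 0 ≤ B) (k N N' : ℕ) :
    ((N' * (N * (2 ^ (k + 1) + 1)) : ℕ) : ℝ) * (3 * (B * ((2 : ℝ) ^ (k + 1)) ^ (-(r + 2)))) ≤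
      6 * B * (levelWeight r k N + levelWeight r (k + 1) N') := by
  unfold levelWeight
  set x : ℝ := 2 ^ (k + 1) with hx
  have hx1 : 1 ≤ x := one_le_pow₀ one_le_two
  have hx0 : 0 < x := by linarith
  have hxr : x ^ (-(r + 2)) * x = x ^ (-(r + 1)) := by
    conv_lhs => rw [← Real.rpow_one x, ← Real.rpow_mul hx0.le, one_mul]
    rw [← Real.rpow_add hx0]
    congr 1
    ring
  have hmono : x ^ (-(r + 1)) ≤ ((2 : ℝ) ^ k) ^ (-(r + 1)) :=
    Real.rpow_le_rpow_of_nonpos (by positivity)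
      (pow_le_pow_right₀ one_le_two (Nat.le_succ k)) (by linarith)
  have hcast : ((N' * (N * (2 ^ (k + 1) + 1)) : ℕ) : ℝ) = N' * N * (x + 1) := by
    push_cast
    rw [hx]
    ring
  rw [hcast]
  have hN : (N' * N : ℝ) ≤ N ^ 2 + N' ^ 2 := by nlinarith [sq_nonneg ((N : ℝ) - N')]
  calc (N' * N * (x + 1) : ℝ) * (3 * (B * x ^ (-(r + 2))))
      ≤ ((N : ℝ) ^ 2 + N' ^ 2) * (2 * x) * (3 * (B * x ^ (-(r + 2)))) := by
        gcongr
        linarith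
    _ = 6 * B * (x ^ (-(r + 1)) * (N : ℝ) ^ 2 + x ^ (-(r + 1)) * (N' : ℝ) ^ 2) := by
        rw [← hxr]
        ring
    _ ≤ _ := by gcongr

theorem MomentSetting.measure_levelEvent_le (h : MomentSetting X P μ normC G p s Φ M)
    {Ψ : ℝ → ℝ} (hΨ : MonotoneOn Ψ (Set.Ici 0)) (hΨ0 : ∀ x, 0 ≤ x → 0 ≤ Ψ x)
    {n k : ℕ} {S S' : Finset (C × C)}
    (hS : ∀ b ∈ S, IsBracket normC G μ s ((2 : ℝ) ^ (k + 1))⁻¹ (Ψ (2 ^ (k + 1))) b.1 b.2)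
    (hS' : ∀ b ∈ S', IsBracket normC G μ s ((2 : ℝ) ^ k)⁻¹ (Ψ (2 ^ k)) b.1 b.2)
    {L c₀ r θ η c : ℝ} {γ : ℕ → ℝ} (hr : -1 < r)
    (hL : 1 ≤ L) (hc₀ : 0 ≤ c₀) (hη : 0 < η) (hc : 0 < c)
    (hxL : ((2 : ℝ) ^ (k + 1)) ^ 2 ≤ L * n)
    (hΦ : ∀ i ∈ Finset.Icc 1 p, Φ i (2 * Ψ (2 ^ (k + 1))) ≤ c₀ * ((2 : ℝ) ^ (k + 1)) ^ γ i)
    (hγ : ∀ i ∈ Finset.Icc 1 p, γ i ≤ 2 * (p : ℝ) - ((i : ℝ) + r + 2) - θ)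
    (hcη : c ^ (2 * p) = η ^ (2 * p) * (((2 : ℝ) ^ (k + 1)) ^ (-θ) * (n : ℝ) ^ p)) :
    P (levelEvent X μ n k c S S') ≤ ENNReal.ofReal
      (6 * (p * ((3 + (1 + L) * M) ^ p * L ^ p * c₀) / η ^ (2 * p)) *
        (levelWeight r k S'.card + levelWeight r (k + 1) S.card)) := by
  have hM := h.one_le_bound
  set B : ℝ := p * ((3 + (1 + L) * M) ^ p * L ^ p * c₀) / η ^ (2 * p) with hB
  have hB0 : 0 ≤ B := by positivity
  refine (measure_biUnion_finset_le _ _).trans ?_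
  refine (Finset.sum_le_sum (g := fun _ => 3 * ENNReal.ofReal
    (B * ((2 : ℝ) ^ (k + 1)) ^ (-(r + 2)))) fun z hz => ?_).trans ?_
  · simp only [Finset.mem_product, Finset.mem_range] at hz
    exact h.measure_stepEvent_le hΨ hΨ0 (hS _ hz.1) (hS' _ hz.2.1) (by omega) hL hc₀ hη hc hxL hΦ
      hγ hcη
  · rw [Finset.sum_const, Finset.card_product, Finset.card_product, Finset.card_range, nsmul_eq_mul]
    rw [show (3 : ℝ≥0∞) = ENNReal.ofReal 3 by simp, ← ENNReal.ofReal_mul (by norm_num),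
      ← ENNReal.ofReal_natCast, ← ENNReal.ofReal_mul (Nat.cast_nonneg _)]
    exact ENNReal.ofReal_le_ofReal (level_count_le hr hB0 k S'.card S.card)

end Measure

/-- Outside the level events, the increments along a chain of brackets are controlled. -/
theorem abs_centredSum_chain_step_le {X : ℕ → Ω → 𝓧} {μ : Measure 𝓧} {n k : ℕ} {c : ℝ}
    {S S' : Finset (C × C)} {ω : Ω} (hω : ω ∉ levelEvent X μ n k c S S') {b b' : C × C}
    (hb : b ∈ S) (hb' : b' ∈ S') (hint : Integrable (b.1 : 𝓧 → ℝ) μ)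
    (hint' : Integrable (b'.1 : 𝓧 → ℝ) μ) {f : 𝓧 → ℝ} (hbf : Encloses b f)
    (hbf' : Encloses b' f) {t : ℝ} (ht1 : t ≤ 1) :
    |centredSum X μ (b'.1 : 𝓧 → ℝ) 0 (grid n k ⌊(2 : ℝ) ^ k * t⌋₊) ω -
      centredSum X μ (b.1 : 𝓧 → ℝ) 0 (grid n (k + 1) ⌊(2 : ℝ) ^ (k + 1) * t⌋₊) ω| ≤ 2 * c ∧
    |centredSum X μ ((b.2 - b.1 : C) : 𝓧 → ℝ) 0 (grid n (k + 1) ⌊(2 : ℝ) ^ (k + 1) * t⌋₊) ω|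
      ≤ c := by
  set j := ⌊(2 : ℝ) ^ (k + 1) * t⌋₊ with hj
  have hj2 : ⌊(2 : ℝ) ^ k * t⌋₊ = j / 2 := (floor_two_pow_succ_mul_half k t).symm
  have hjle : j ≤ 2 ^ (k + 1) := floor_two_pow_mul_le ht1 _
  have hstep : ω ∉ stepEvent X μ n k c b b' j := fun hmem => hω (Set.mem_iUnion₂.2
    ⟨(b, b', j), by simpa [hb, hb'] using Nat.lt_succ_of_le hjle, hmem⟩)
  simp only [stepEvent, Set.mem_union, Set.mem_ofPred_eq, not_or, not_lt, not_and] at hstep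
  obtain ⟨⟨h1, h2⟩, h3⟩ := hstep
  refine ⟨?_, h3⟩
  have h2' := h2 ⟨f, hbf, hbf'⟩
  rw [AddSubgroupClass.coe_sub, centredSum_sub hint hint'] at h2'
  -- The step splits into a change of function at the coarser time and a move in time for the finer
  -- function, each at most `c`.
  rw [hj2, ← centredSum_add_adjacent (Nat.zero_le _) (grid_half_le n k j)]
  rw [abs_le] at h1 h2' ⊢
  constructor <;> linarith [h1.1, h1.2, h2'.1, h2'.2]

end Chaining

/-! ### Choice of the parameters -/

section Auxiliary

/-- The slack `θ` in finitely many strict inequalities pays for thresholds that decay geometrically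
in the level. -/
theorem exists_pos_gap {p : ℕ} {r : ℝ} {γ : ℕ → ℝ}
    (hγ : ∀ i ∈ Finset.Icc 1 p, γ i < 2 * (p : ℝ) - ((i : ℝ) + r + 2)) :
    ∃ θ : ℝ, 0 < θ ∧ ∀ i ∈ Finset.Icc 1 p, γ i ≤ 2 * (p : ℝ) - ((i : ℝ) + r + 2) - θ := by
  have h : ∀ᶠ θ in 𝓝[>] (0 : ℝ), ∀ i ∈ Finset.Icc 1 p,
      θ ≤ 2 * (p : ℝ) - ((i : ℝ) + r + 2) - γ i := by
    rw [Finset.eventually_all]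
    intro i hi
    exact (eventually_le_nhds (sub_pos.2 (hγ i hi))).filter_mono nhdsWithin_le_nhds
  obtain ⟨θ, hθ, hθ0⟩ := (h.and self_mem_nhdsWithin).exists
  exact ⟨θ, hθ0, fun i hi => by linarith [hθ i hi]⟩

theorem exists_dyadic_growth_bound {p : ℕ} {Φ : ℕ → ℝ → ℝ} {Ψ : ℝ → ℝ} {γ : ℕ → ℝ}
    (hΦΨ : ∀ i ∈ Finset.Icc 1 p,
      (fun x : ℝ => Φ i (2 * Ψ x)) =O[atTop] (fun x : ℝ => x ^ γ i)) :
    ∃ c₀ : ℝ, 0 ≤ c₀ ∧ ∃ k₀ : ℕ, ∀ k, k₀ ≤ k → ∀ i ∈ Finset.Icc 1 p,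
      Φ i (2 * Ψ (2 ^ k)) ≤ c₀ * ((2 : ℝ) ^ k) ^ γ i := by
  choose! c hc using fun i hi => (hΦΨ i hi).bound
  refine ⟨∑ i ∈ Finset.Icc 1 p, |c i|, Finset.sum_nonneg fun _ _ => abs_nonneg _, ?_⟩
  have hev : ∀ᶠ x : ℝ in atTop, ∀ i ∈ Finset.Icc 1 p, ‖Φ i (2 * Ψ x)‖ ≤ c i * ‖x ^ γ i‖ := by
    rw [Finset.eventually_all]
    exact hc
  obtain ⟨k₀, hk₀⟩ := eventually_atTop.1
    ((tendsto_pow_atTop_atTop_of_one_lt one_lt_two).eventually hev)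
  refine ⟨k₀, fun k hk i hi => ?_⟩
  refine (le_abs_self _).trans ((hk₀ k hk i hi).trans ?_)
  rw [Real.norm_of_nonneg (by positivity)]
  gcongr
  exact (le_abs_self _).trans
    (Finset.single_le_sum (f := fun i => |c i|) (fun _ _ => abs_nonneg _) hi)

theorem exists_tail_sum_le {D : ℕ → ℝ} (hD : Summable D) {κ : ℝ} (hκ : 0 < κ) :
    ∃ q₀, ∀ q, q₀ ≤ q → ∀ K, ∑ k ∈ Finset.Ico q K, D k ≤ κ := by
  obtain ⟨s, hs⟩ := summable_iff_vanishing_norm.1 hD κ hκ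
  refine ⟨s.sup id + 1, fun q hq K => ?_⟩
  refine (le_abs_self _).trans (hs _ ?_).le
  rw [Finset.disjoint_left]
  intro k hk hks
  have : k ≤ s.sup id := Finset.le_sup (f := id) hks
  have := (Finset.mem_Ico.1 hk).1
  omega

/-- The stopping level, chosen with `2^(K-1) ≤ √n / η < 2^K`. It is low enough for the tail bounds
to apply with `L = 4 / η²`, and high enough for the means of the last brackets to be negligible. -/
theorem exists_two_pow_near_sqrt {η : ℝ} (hη : 0 < η) (hη1 : η ≤ 1) (q : ℕ) :
    ∀ᶠ n : ℕ in atTop, 1 ≤ η * √(n : ℝ) ∧ ∃ K, q < K ∧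
      ((2 : ℝ) ^ K) ^ 2 ≤ 4 / η ^ 2 * n ∧ (n : ℝ) / 2 ^ K ≤ η * √(n : ℝ) := by
  have hsqrt : Tendsto (fun n : ℕ => √(n : ℝ)) atTop atTop :=
    Real.tendsto_sqrt_atTop.comp tendsto_natCast_atTop_atTop
  filter_upwards [hsqrt.eventually_gt_atTop (2 ^ q), hsqrt.eventually_ge_atTop (1 / η)]
    with n hn1 hn2
  have hn0 : 0 < √(n : ℝ) := lt_trans (by positivity) hn1
  have hsq : √(n : ℝ) * √(n : ℝ) = n := Real.mul_self_sqrt (Nat.cast_nonneg n)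
  have hle : √(n : ℝ) ≤ √(n : ℝ) / η := by
    rw [le_div_iff₀ hη]
    exact mul_le_of_le_one_right hn0.le hη1
  have h1 : 1 ≤ √(n : ℝ) / η := le_trans (le_trans (one_le_pow₀ one_le_two) hn1.le) hle
  refine ⟨by rwa [div_le_iff₀' hη] at hn2, ?_⟩
  obtain ⟨k, hk1, hk2⟩ := exists_nat_pow_near h1 one_lt_two
  refine ⟨k + 1, ?_, ?_, ?_⟩
  · exact (pow_lt_pow_iff_right₀ (one_lt_two (α := ℝ))).1 ((hn1.trans_le hle).trans hk2)
  · calc ((2 : ℝ) ^ (k + 1)) ^ 2 = 4 * ((2 : ℝ) ^ k) ^ 2 := by ring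
      _ ≤ 4 * (√(n : ℝ) / η) ^ 2 := by gcongr
      _ = 4 / η ^ 2 * (√(n : ℝ) * √(n : ℝ)) := by ring
      _ = _ := by rw [hsq]
  · rw [div_le_iff₀ (by positivity)]
    calc (n : ℝ) = √(n : ℝ) * √(n : ℝ) := hsq.symm
      _ = η * √(n : ℝ) * (√(n : ℝ) / η) := by field_simp
      _ ≤ _ := by gcongr

/-- Take `ρ = 2^(-θ/(2p))`: the thresholds `η ρ^k √n` are summable over levels, while their `2p`-th
powers lose only `2^(-kθ)`. -/
theorem exists_geometric_weight {p : ℕ} (hp : 1 ≤ p) {θ : ℝ} (hθ : 0 < θ) :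
    ∃ ρ : ℝ, 0 < ρ ∧ ρ < 1 ∧ ∀ k : ℕ, (ρ ^ k) ^ (2 * p) = ((2 : ℝ) ^ k) ^ (-θ) := by
  have hp0 : (0 : ℝ) < p := by exact_mod_cast hp
  have hρ : (0 : ℝ) < 2 ^ (-(θ / (2 * p))) := by positivity
  refine ⟨(2 : ℝ) ^ (-(θ / (2 * p))), hρ,
    Real.rpow_lt_one_of_one_lt_of_neg one_lt_two (neg_lt_zero.2 (by positivity)), fun k => ?_⟩
  rw [← Real.rpow_natCast, ← Real.rpow_natCast, ← Real.rpow_natCast, ← Real.rpow_mul hρ.le,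
    ← Real.rpow_mul (by norm_num), ← Real.rpow_mul (by norm_num)]
  congr 1
  push_cast
  field_simp

theorem integral_le_of_eLpNorm_le {𝓧 : Type*} [MeasurableSpace 𝓧] {μ : Measure 𝓧}
    [IsProbabilityMeasure μ] {g : 𝓧 → ℝ} (hg : Measurable g) {s : ℝ≥0∞} (hs : 1 ≤ s) {ε : ℝ}
    (hε : 0 ≤ ε) (h : eLpNorm g s μ ≤ ENNReal.ofReal ε) : ∫ x, g x ∂μ ≤ ε := by
  refine (le_abs_self _).trans ((norm_integral_le_integral_norm g).trans ?_)
  rw [integral_norm_eq_lintegral_enorm hg.aestronglyMeasurable, ← eLpNorm_one_eq_lintegral_enorm]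
  exact ENNReal.toReal_le_of_le_ofReal hε
    ((eLpNorm_le_eLpNorm_of_exponent_le hs hg.aestronglyMeasurable).trans h)

end Auxiliary

/-! ### Uniform approximation by chaining -/

section UniformApproximation

variable {Ω 𝓧 : Type*} [MeasurableSpace Ω] [MeasurableSpace 𝓧] {C : Submodule ℝ (𝓧 → ℝ)}
  {X : ℕ → Ω → 𝓧} {P : Measure Ω} [IsProbabilityMeasure P] {μ : Measure 𝓧}
  {normC : Seminorm ℝ C} {G : Set C} {p : ℕ} {s : ℝ≥0∞} {Φ : ℕ → ℝ → ℝ} {M : ℝ}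
  {F : Set (𝓧 → ℝ)}

theorem MomentSetting.integrable_of_encloses (h : MomentSetting X P μ normC G p s Φ M)
    {f : 𝓧 → ℝ} (hf : Measurable f) {b : C × C} (hb1 : b.1 ∈ G) (hb2 : b.2 ∈ G)
    (hbf : Encloses b f) : Integrable f μ := by
  have := h.isProbabilityMeasure
  refine Integrable.of_bound hf.aestronglyMeasurable M ?_
  filter_upwards [h.bound _ hb1, h.bound _ hb2] with x h1 h2
  exact abs_le.2 ⟨(abs_le.1 h1).1.trans (hbf x).1, (hbf x).2.trans (abs_le.1 h2).2⟩

/-- Pathwise chaining: outside the level events between `q` and `K`, the partial sums of `f` are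
close to those of its lower bracket at level `q`. -/
theorem MomentSetting.abs_centredSum_sub_le (h : MomentSetting X P μ normC G p s Φ M)
    {Ψ : ℝ → ℝ} {S : ℕ → Finset (C × C)}
    (hS : ∀ k, ∀ b ∈ S k, IsBracket normC G μ s ((2 : ℝ) ^ k)⁻¹ (Ψ (2 ^ k)) b.1 b.2)
    {f : 𝓧 → ℝ} (hf : Measurable f) {β : ℕ → C × C} (hβ : ∀ k, β k ∈ S k)
    (hβf : ∀ k, Encloses (β k) f) {n q K : ℕ} (hqK : q < K) {η ρ : ℝ} (hη : 0 < η) (hρ0 : 0 < ρ)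
    (hρ1 : ρ < 1) (hn1 : 1 ≤ η * √(n : ℝ)) (hnK : (n : ℝ) / 2 ^ K ≤ η * √(n : ℝ)) {ω : Ω}
    (hω : ∀ k, q ≤ k → k < K →
      ω ∉ levelEvent X μ n k (η * ρ ^ (k + 1) * √(n : ℝ)) (S (k + 1)) (S k))
    (hωM : ∀ b ∈ S K, (∀ i, |(b.1 : 𝓧 → ℝ) (X i ω)| ≤ M) ∧ ∀ i, |(b.2 : 𝓧 → ℝ) (X i ω)| ≤ M)
    {t : ℝ} (ht0 : 0 ≤ t) (ht1 : t ≤ 1) :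
    |centredSum X μ f 0 ⌊(n : ℝ) * t⌋₊ ω -
      centredSum X μ ((β q).1 : 𝓧 → ℝ) 0 (grid n q ⌊(2 : ℝ) ^ q * t⌋₊) ω| ≤
      η * (6 * M + 2 * (1 - ρ)⁻¹) * √(n : ℝ) := by
  have hμP := h.isProbabilityMeasure
  have hM := h.one_le_bound
  have hsub := fun k => hS k _ (hβ k)
  have hint1 := fun k => h.integrable (Or.inl (hsub k).mem_left)
  have hint2 := fun k => h.integrable (Or.inl (hsub k).mem_right)
  set T : ℕ → ℝ := fun k =>
    centredSum X μ ((β k).1 : 𝓧 → ℝ) 0 (grid n k ⌊(2 : ℝ) ^ k * t⌋₊) ω with hT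
  have hstep := fun k (hqk : q ≤ k) (hkK : k < K) => abs_centredSum_chain_step_le (hω k hqk hkK)
    (hβ (k + 1)) (hβ k) (hint1 _) (hint1 _) (hβf _) (hβf _) ht1
  have hchain : |T q - T K| ≤ η * (2 * (1 - ρ)⁻¹) * √(n : ℝ) := by
    have h1 : dist (T q) (T K) ≤ ∑ k ∈ Finset.Ico q K, 2 * (η * ρ ^ (k + 1) * √(n : ℝ)) :=
      dist_le_Ico_sum_of_dist_le hqK.le fun hqk hkK => (hstep _ hqk hkK).1
    refine h1.trans ?_
    have h2 : ∑ k ∈ Finset.Ico q K, ρ ^ (k + 1) ≤ (1 - ρ)⁻¹ := by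
      rw [← tsum_geometric_of_lt_one hρ0.le hρ1]
      refine le_trans (Finset.sum_le_sum fun k _ => ?_)
        ((summable_geometric_of_lt_one hρ0.le hρ1).sum_le_tsum (Finset.Ico q K)
          fun k _ => by positivity)
      exact pow_le_pow_of_le_one hρ0.le hρ1.le (Nat.le_succ k)
    calc ∑ k ∈ Finset.Ico q K, 2 * (η * ρ ^ (k + 1) * √(n : ℝ))
        = (η * 2 * √(n : ℝ)) * ∑ k ∈ Finset.Ico q K, ρ ^ (k + 1) := by
          rw [Finset.mul_sum]
          exact Finset.sum_congr rfl fun _ _ => by ring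
      _ ≤ (η * 2 * √(n : ℝ)) * (1 - ρ)⁻¹ := by gcongr
      _ = _ := by ring
  obtain ⟨k, rfl⟩ : ∃ k, K = k + 1 := ⟨K - 1, by omega⟩
  -- In units of `η √n`: the leftover block has length at most `n / 2^K + 1`, so it gives `2 · 2M`;
  -- the fluctuation and the mean of the last bracket width give `1` each, and `1 ≤ M`.
  have hlast : |centredSum X μ f 0 ⌊(n : ℝ) * t⌋₊ ω - T (k + 1)| ≤ η * (6 * M) * √(n : ℝ) := by
    have hb := hsub (k + 1)
    have h1 := abs_centredSum_sub_le_of_bracket (X := X) (μ := μ) (ω := ω) (M := M)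
      (h.integrable_of_encloses hf hb.mem_left hb.mem_right (hβf (k + 1))) (hint1 (k + 1))
      (hint2 (k + 1)) (fun x => (hβf (k + 1) x).1) (fun x => (hβf (k + 1) x).2)
      (h.bound _ hb.mem_left) (h.bound _ hb.mem_right) (hωM _ (hβ _)).1 (hωM _ (hβ _)).2
      (grid_floor_le ht0 n (k + 1))
    have h2 := (hstep k (by omega) (by omega)).2
    rw [AddSubgroupClass.coe_sub] at h2
    have h3 : η * ρ ^ (k + 1) * √(n : ℝ) ≤ η * √(n : ℝ) := by
      gcongr
      exact mul_le_of_le_one_right hη.le (pow_le_one₀ hρ0.le hρ1.le)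
    have h4 : ∫ x, (((β (k + 1)).2 : 𝓧 → ℝ) - ((β (k + 1)).1 : 𝓧 → ℝ)) x ∂μ ≤
        ((2 : ℝ) ^ (k + 1))⁻¹ :=
      integral_le_of_eLpNorm_le ((h.measC _ (β (k + 1)).2.2).sub (h.measC _ (β (k + 1)).1.2))
        h.one_le (by positivity) hb.eLpNorm_sub_le
    have h5 : (grid n (k + 1) ⌊(2 : ℝ) ^ (k + 1) * t⌋₊ : ℝ) ≤ n := by
      exact_mod_cast grid_le (floor_two_pow_mul_le ht1 _)
    have h6 : (grid n (k + 1) ⌊(2 : ℝ) ^ (k + 1) * t⌋₊ : ℝ) *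
        ∫ x, (((β (k + 1)).2 : 𝓧 → ℝ) - ((β (k + 1)).1 : 𝓧 → ℝ)) x ∂μ ≤ η * √(n : ℝ) := by
      refine le_trans ?_ hnK
      rw [div_eq_mul_inv]
      exact (mul_le_mul_of_nonneg_left h4 (Nat.cast_nonneg _)).trans (by gcongr)
    have h7 := floor_sub_grid_floor_le ht0 n (k + 1)
    have h8 : ((⌊(n : ℝ) * t⌋₊ : ℝ) - grid n (k + 1) ⌊(2 : ℝ) ^ (k + 1) * t⌋₊) * (2 * M) ≤
        (η * √(n : ℝ) + η * √(n : ℝ)) * (2 * M) := by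
      gcongr
      linarith
    have h9 : η * √(n : ℝ) * 1 ≤ η * √(n : ℝ) * M := by gcongr
    refine h1.trans ?_
    linarith
  have := abs_sub_le (centredSum X μ f 0 ⌊(n : ℝ) * t⌋₊ ω) (T (k + 1)) (T q)
  rw [abs_sub_comm (T (k + 1))] at this
  linarith

/-- The sequential empirical process is uniformly approximated in probability by its values at the
lower brackets and the dyadic times of a fixed level. -/
theorem MomentSetting.exists_uniform_approx (h : MomentSetting X P μ normC G p s Φ M)
    (hp : 1 ≤ p) (hF : ∀ f ∈ F, Measurable f)
    {Ψ : ℝ → ℝ} (hΨ : MonotoneOn Ψ (Set.Ici 0)) (hΨ0 : ∀ x, 0 ≤ x → 0 ≤ Ψ x)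
    {S : ℕ → Finset (C × C)}
    (hS : ∀ k, ∀ b ∈ S k, IsBracket normC G μ s ((2 : ℝ) ^ k)⁻¹ (Ψ (2 ^ k)) b.1 b.2)
    {β : ℕ → F → C × C} (hβ : ∀ k f, β k f ∈ S k) (hβf : ∀ k (f : F), Encloses (β k f) f)
    {r : ℝ} (hr : -1 < r) (hsum : Summable fun k => levelWeight r k (S k).card) {γ : ℕ → ℝ}
    (hΦΨ : ∀ i ∈ Finset.Icc 1 p,
      (fun x : ℝ => Φ i (2 * Ψ x)) =O[atTop] (fun x : ℝ => x ^ γ i))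
    (hγ : ∀ i ∈ Finset.Icc 1 p, γ i < 2 * (p : ℝ) - ((i : ℝ) + r + 2))
    (δ : ℝ) (hδ : 0 < δ) (κ : ℝ≥0∞) (hκ : 0 < κ) :
    ∃ q₀, ∀ q, q₀ ≤ q → ∀ᶠ n : ℕ in atTop,
      P {ω | ∃ τ : F × Set.Icc (0 : ℝ) 1, δ < |seqEmpirical X μ n τ.1 τ.2 ω -
        seqEmpirical X μ n ((β q τ.1).1 : 𝓧 → ℝ) (⌊(2 : ℝ) ^ q * τ.2⌋₊ / 2 ^ q) ω|} ≤ κ := by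
  have hM := h.one_le_bound
  obtain ⟨θ, hθ, hγθ⟩ := exists_pos_gap hγ
  obtain ⟨c₀, hc₀, k₀, hk₀⟩ := exists_dyadic_growth_bound hΦΨ
  obtain ⟨ρ, hρ0, hρ1, hρθ⟩ := exists_geometric_weight hp hθ
  have hρ' : 0 < 1 - ρ := by linarith
  set R : ℝ := 6 * M + 2 * (1 - ρ)⁻¹ with hR
  have hR0 : 0 < R := by positivity
  -- `R` is the constant of the pathwise bound, so `η R ≤ δ`; the cap at `1` ensures `L ≥ 1`.
  set η : ℝ := min 1 (δ / R) with hηdef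
  have hη : 0 < η := lt_min one_pos (by positivity)
  have hη1 : η ≤ 1 := min_le_left _ _
  have hηR : η * R ≤ δ := (le_div_iff₀ hR0).1 (min_le_right _ _)
  set L : ℝ := 4 / η ^ 2 with hLdef
  have hL : 1 ≤ L := by
    rw [hLdef, le_div_iff₀ (by positivity)]
    nlinarith
  set B : ℝ := 6 * (p * ((3 + (1 + L) * M) ^ p * L ^ p * c₀) / η ^ (2 * p)) with hB
  set D : ℕ → ℝ := fun k =>
    B * (levelWeight r k (S k).card + levelWeight r (k + 1) (S (k + 1)).card) with hD
  have hD0 : ∀ k, 0 ≤ D k := fun k => mul_nonneg (by positivity)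
    (add_nonneg (levelWeight_nonneg _ _ _) (levelWeight_nonneg _ _ _))
  have hDsum : Summable D := (hsum.add ((summable_nat_add_iff 1).2 hsum)).mul_left B
  obtain ⟨κ', hκ'0, hκ'⟩ : ∃ κ' : ℝ, 0 < κ' ∧ ENNReal.ofReal κ' ≤ κ := by
    obtain ⟨x, hx0, hx⟩ := ENNReal.lt_iff_exists_nnreal_btwn.1 hκ
    exact ⟨x, by exact_mod_cast hx0, by rw [ENNReal.ofReal_coe_nnreal]; exact hx.le⟩
  -- `D` depends on `η` but not on `q`, `n` or `K`, so a tail of its series bounds the total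
  -- probability for every `n`.
  obtain ⟨q₁, hq₁⟩ := exists_tail_sum_le hDsum hκ'0
  refine ⟨max q₁ k₀, fun q hq => ?_⟩
  filter_upwards [exists_two_pow_near_sqrt hη hη1 q] with n ⟨hn1, K, hqK, hKL, hnK⟩
  have hn0 : 0 < √(n : ℝ) := by
    by_contra hcon
    nlinarith
  have hae : ∀ᵐ ω ∂P, ∀ b ∈ S K,
      (∀ i, |(b.1 : 𝓧 → ℝ) (X i ω)| ≤ M) ∧ ∀ i, |(b.2 : 𝓧 → ℝ) (X i ω)| ≤ M :=
    (ae_ball_iff (S K).countable_toSet).2 fun b hb =>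
      (h.stat.ae_comp h.meas h.map (h.bound _ (hS K b hb).mem_left)).and
        (h.stat.ae_comp h.meas h.map (h.bound _ (hS K b hb).mem_right))
  -- The inclusion holds only almost surely, since bracket ends are bounded only `μ`-almost
  -- everywhere.
  refine (measure_mono_ae (t := ⋃ k ∈ Finset.Ico q K,
    levelEvent X μ n k (η * ρ ^ (k + 1) * √(n : ℝ)) (S (k + 1)) (S k)) ?_).trans ?_
  · filter_upwards [hae] with ω hωM hωδ
    by_contra hcon
    obtain ⟨⟨f, t⟩, hft⟩ := hωδ
    have hω : ∀ k, q ≤ k → k < K →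
        ω ∉ levelEvent X μ n k (η * ρ ^ (k + 1) * √(n : ℝ)) (S (k + 1)) (S k) :=
      fun k h1 h2 hmem => hcon (Set.mem_iUnion₂.2 ⟨k, Finset.mem_Ico.2 ⟨h1, h2⟩, hmem⟩)
    have hpath := h.abs_centredSum_sub_le hS (hF f f.2) (fun k => hβ k f) (fun k => hβf k f) hqK hη
      hρ0 hρ1 hn1 hnK hω hωM t.2.1 t.2.2
    rw [seqEmpirical_eq_centredSum, seqEmpirical_eq_centredSum, floor_mul_dyadic, ← mul_sub,
      abs_mul, abs_of_pos (by positivity), one_div, inv_mul_eq_div, lt_div_iff₀ hn0] at hft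
    have : η * R * √(n : ℝ) ≤ δ * √(n : ℝ) := by gcongr
    linarith
  · refine (measure_biUnion_finset_le _ _).trans (le_trans (Finset.sum_le_sum
      (g := fun k => ENNReal.ofReal (D k)) fun k hk => ?_) ?_)
    · obtain ⟨hqk, hkK⟩ := Finset.mem_Ico.1 hk
      refine h.measure_levelEvent_le hΨ hΨ0 (hS (k + 1)) (hS k) hr hL hc₀ hη (by positivity)
        (le_trans ?_ hKL) (hk₀ (k + 1) ?_) hγθ ?_
      · gcongr
        · exact one_le_two
        · omega
      · have := le_max_right q₁ k₀
        omega
      · rw [mul_pow, mul_pow, hρθ, pow_mul (√(n : ℝ)), Real.sq_sqrt (Nat.cast_nonneg n)]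
        ring
    · rw [← ENNReal.ofReal_sum_of_nonneg fun k _ => hD0 k]
      exact (ENNReal.ofReal_le_ofReal (hq₁ q ((le_max_left _ _).trans hq) K)).trans hκ'

end UniformApproximation

/-! ### Boundedness of the paths and conclusion -/

section Main

variable {Ω 𝓧 : Type*} [MeasurableSpace 𝓧] {C : Submodule ℝ (𝓧 → ℝ)}

/-- A class covered by finitely many brackets with real-valued ends has uniformly bounded partial
sum paths. -/
theorem exists_abs_seqEmpirical_le {F : Set (𝓧 → ℝ)} {μ : Measure 𝓧} {M : ℝ}
    (hFμ : ∀ f ∈ F, |∫ x, f x ∂μ| ≤ M) {S : Finset (C × C)}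
    (hS : ∀ f ∈ F, ∃ b ∈ S, Encloses b f) (X : ℕ → Ω → 𝓧) (n : ℕ) (ω : Ω) :
    ∃ K, ∀ τ : F × Set.Icc (0 : ℝ) 1, |seqEmpirical X μ n τ.1 τ.2 ω| ≤ K := by
  -- Functions of `F` are bounded only almost everywhere, each off its own null set; the real-valued
  -- bracket ends supply an envelope valid at every point.
  let H : 𝓧 → ℝ := fun x => ∑ b ∈ S, (|(b.1 : 𝓧 → ℝ) x| + |(b.2 : 𝓧 → ℝ) x|)
  have hH : ∀ f ∈ F, ∀ x, |f x| ≤ H x := fun f hf x => by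
    obtain ⟨b, hb, hbf⟩ := hS f hf
    refine le_trans ?_ (Finset.single_le_sum
      (f := fun b : C × C => |(b.1 : 𝓧 → ℝ) x| + |(b.2 : 𝓧 → ℝ) x|) (fun _ _ => by positivity) hb)
    have h1 := neg_abs_le ((b.1 : 𝓧 → ℝ) x)
    have h2 := le_abs_self ((b.2 : 𝓧 → ℝ) x)
    have h3 := abs_nonneg ((b.1 : 𝓧 → ℝ) x)
    have h4 := abs_nonneg ((b.2 : 𝓧 → ℝ) x)
    exact abs_le.2 ⟨by linarith [(hbf x).1], by linarith [(hbf x).2]⟩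
  refine ⟨1 / √(n : ℝ) * ∑ i ∈ Finset.Icc 1 n, (H (X i ω) + M), fun ⟨f, t⟩ => ?_⟩
  have hterm : ∀ i, |(f : 𝓧 → ℝ) (X i ω) - ∫ x, (f : 𝓧 → ℝ) x ∂μ| ≤ H (X i ω) + M := fun i =>
    (abs_sub _ _).trans (add_le_add (hH f f.2 _) (hFμ f f.2))
  rw [seqEmpirical, abs_mul, abs_of_nonneg (by positivity)]
  gcongr
  refine (Finset.abs_sum_le_sum_abs _ _).trans ((Finset.sum_le_sum fun i _ => hterm i).trans ?_)
  refine Finset.sum_le_sum_of_subset_of_nonneg (Finset.Icc_subset_Icc_right ?_)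
    fun i _ _ => (abs_nonneg _).trans (hterm i)
  exact Nat.floor_le_of_le (mul_le_of_le_one_right (Nat.cast_nonneg n) t.2.2)

end Main

end SeqEmp

end

theorem mainTheorem2
    {Ω 𝓧 : Type*} [MeasurableSpace Ω] [MeasurableSpace 𝓧]
    (P : Measure Ω) [IsProbabilityMeasure P]
    (X : ℕ → Ω → 𝓧) (hX : ∀ i, Measurable (X i)) (hstat : SeqEmp.IsStationary X P)
    (μ : Measure 𝓧) (hμ : P.map (X 0) = μ)
    (F : Set (𝓧 → ℝ)) (hFmeas : ∀ f ∈ F, Measurable f) (hFbdd : SeqEmp.IsSupNormBounded μ F)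
    -- the normed vector space `C` of measurable functions, with norm `normC`
    (C : Submodule ℝ (𝓧 → ℝ)) (hCmeas : ∀ g ∈ C, Measurable g)
    (normC : Seminorm ℝ C) (hnormC : ∀ g : C, normC g = 0 → g = 0)
    (G : Set C) (hGbdd : SeqEmp.IsSupNormBounded μ ((fun g : C => (g : 𝓧 → ℝ)) '' G))
    (p : ℕ) (hp : 1 ≤ p) (s : ℝ≥0∞) (hs : 1 ≤ s)
    (Φ : ℕ → ℝ → ℝ)
    (hΦmono : ∀ i ∈ Finset.Icc 1 p, MonotoneOn (Φ i) (Set.Ici 0))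
    (hΦnonneg : ∀ i ∈ Finset.Icc 1 p, ∀ x, 0 ≤ x → 0 ≤ Φ i x)
    (hclt : SeqEmp.FidiSeqCLT X P μ G)
    (hmom : SeqEmp.MomentBound X P μ normC G p s Φ)
    (r : ℝ) (hr : -1 < r)
    (Ψ : ℝ → ℝ) (hΨmono : MonotoneOn Ψ (Set.Ici 0)) (hΨnonneg : ∀ x, 0 ≤ x → 0 ≤ Ψ x)
    (hbracket : SeqEmp.bracketingIntegral normC G μ s r Ψ F < ∞)
    (γ : ℕ → ℝ) (hγnonneg : ∀ i ∈ Finset.Icc 1 p, 0 ≤ γ i)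
    (hΦΨ : ∀ i ∈ Finset.Icc 1 p,
      (fun x : ℝ => Φ i (2 * Ψ x)) =O[atTop] (fun x : ℝ => x ^ γ i))
    (hγ : ∀ i ∈ Finset.Icc 1 p, γ i < 2 * (p : ℝ) - ((i : ℝ) + r + 2)) :
    ∃ U : ℕ → Ω → SeqEmp.LInfty (F × Set.Icc (0 : ℝ) 1),
      (∀ (n : ℕ) (ω : Ω) (f : F) (t : Set.Icc (0 : ℝ) 1),
        U n ω (f, t) = SeqEmp.seqEmpirical X μ n (f : 𝓧 → ℝ) (t : ℝ) ω) ∧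
      ∃ ν : Measure (SeqEmp.LInfty (F × Set.Icc (0 : ℝ) 1)),
        IsProbabilityMeasure ν ∧ IsTightMeasureSet {ν} ∧ SeqEmp.IsCentredGaussianLaw ν ∧
          SeqEmp.WeakConvergesTo P U ν := by
  have hμP : IsProbabilityMeasure μ := by
    rw [← hμ]
    exact Measure.isProbabilityMeasure_map (hX 0).aemeasurable
  obtain ⟨M₀, hM₀⟩ := hGbdd
  obtain ⟨M₁, hM₁⟩ := hFbdd
  have hset : SeqEmp.MomentSetting X P μ normC G p s Φ (max 1 M₀) :=
    ⟨hX, hstat, hμ, hCmeas, hs, le_max_left _ _, fun g hg => by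
      filter_upwards [hM₀ _ ⟨g, hg, rfl⟩] with x hx using hx.trans (le_max_right _ _),
      hΦmono, hΦnonneg, hmom⟩
  have hFμ : ∀ f ∈ F, |∫ x, f x ∂μ| ≤ M₁ := fun f hf => by
    simpa using norm_integral_le_of_norm_le_const (μ := μ) (f := f) (C := M₁) (hM₁ f hf)
  obtain ⟨S, hS, hSF, hsum⟩ := SeqEmp.exists_dyadic_covers hbracket
  choose β hβ hβf using fun k (f : F) => hSF k f f.2
  let U : ℕ → Ω → SeqEmp.LInfty (F × Set.Icc (0 : ℝ) 1) := fun n ω =>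
    SeqEmp.LInfty.ofBounded (fun τ => SeqEmp.seqEmpirical X μ n τ.1 τ.2 ω)
      (SeqEmp.exists_abs_seqEmpirical_le hFμ (hSF 0) X n ω)
  refine ⟨U, fun n ω f t => rfl, ?_⟩
  -- The coordinates of level `q` are pairs of a bracket and a dyadic index; the index `2^q` is
  -- needed for `t = 1`.
  let J : ℕ → Finset ((C × C) × ℕ) := fun q => S q ×ˢ Finset.range (2 ^ q + 1)
  let e : ∀ q, J q ≃ Fin (J q).card := fun q => (J q).equivFin
  have hmem : ∀ q (τ : F × Set.Icc (0 : ℝ) 1), (β q τ.1, ⌊(2 : ℝ) ^ q * τ.2⌋₊) ∈ J q :=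
    fun q τ => Finset.mem_product.2 ⟨hβ q τ.1, Finset.mem_range.2
      (Nat.lt_succ_of_le (SeqEmp.floor_two_pow_mul_le τ.2.2.2 q))⟩
  have hfidi := fun q => hclt (J q).card (fun i => ((e q).symm i).1.1.1)
    (fun i => (((e q).symm i).1.2 : ℝ) / 2 ^ q)
    (fun i => (hS q _ (Finset.mem_product.1 ((e q).symm i).2).1).mem_left)
    (fun i => ⟨by positivity, by
      have := Finset.mem_range.1 (Finset.mem_product.1 ((e q).symm i).2).2
      rw [div_le_one (by positivity)]
      exact_mod_cast Nat.le_of_lt_succ this⟩)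
  choose V _ hV using hfidi
  refine SeqEmp.exists_gaussian_weakConvergesTo (k := fun q => (J q).card)
    (fun q τ => e q ⟨_, hmem q τ⟩) _ (fun q n => ?_) V hV fun δ hδ κ hκ => ?_
  · refine (WithLp.measurable_toLp 2 _).comp (measurable_pi_lambda _ fun i => ?_)
    exact (SeqEmp.measurable_centredSum hX (hCmeas _ (Subtype.property _))).const_mul _
  · obtain ⟨q₀, hq₀⟩ := hset.exists_uniform_approx hp hFmeas hΨmono hΨnonneg hS hβ hβf hr hsum hΦΨ
      hγ δ hδ κ hκ
    refine ⟨q₀, fun q hq => (hq₀ q hq).mono fun n hn => le_of_eq_of_le ?_ hn⟩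
    congr 1
    ext ω
    simp [U]
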